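/- Let $R$ be a Dedekind domain whose field of fractions $K$ is a number field. For an $R$-order $\Lambda$ in a finite-dimensional semisimple $K$-algebra (a subring that is a finitely generated $R$-submodule spanning the algebra over $K$), say that $\Lambda$ has stably free cancellation (SFC) if for every finitely generated left $\Lambda$-module $X$ and all $m,n\ge 0$, $X\oplus\Lambda^{(m)}\cong\Lambda^{(m+n)}$ implies $X\cong\Lambda^{(n)}$. Let $\mathrm{Cl}(\Lambda)$ be the locally free class group of $\Lambda$: its elements are the stable isomorphism classes $[X]_{\mathrm{st}}$ of locally free left $\Lambda$-lattices $X$ of rank $1$ (left $\Lambda$-modules $X$ that are finitely generated and torsion-free over $R$ and satisfy $X_{\mathfrak p}\cong\Lambda_{\mathfrak p}$ as $\Lambda_{\mathfrak p}$-modules for every maximal ideal $\mathfrak p$ of $R$), where $X$ and $Y$ are stably isomorphic if $X\oplus\Lambda^{(m)}\cong Y\oplus\Lambda^{(m)}$ for some $m\ge 0$; its identity element is $[\Lambda]_{\mathrm{st}}$, and $[X_1]_{\mathrm{st}}+[X_2]_{\mathrm{st}}=[X_3]_{\mathrm{st}}$ whenever $X_1\oplus X_2\cong\Lambda\oplus X_3$.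 Let $\Lambda,\Lambda_1,\Lambda_2$ be $R$-orders in finite-dimensional semisimple $K$-algebras $A,A_1,A_2$, let $\overline{\Lambda}$ be an $R$-algebra that is torsion as an $R$-module, and suppose that $R$-algebra homomorphisms $\pi_i\colon\Lambda\to\Lambda_i$ and $g_i\colon\Lambda_i\to\overline{\Lambda}$ ($i=1,2$) form a fibre product, that is, $x\mapsto(\pi_1(x),\pi_2(x))$ is a bijection from $\Lambda$ onto $\{(x_1,x_2)\in\Lambda_1\oplus\Lambda_2 : g_1(x_1)=g_2(x_2)\}$. Assume that at least one of $g_1,g_2$ is surjective. For $u\in\overline{\Lambda}^{\times}$ let \[ M(u)=\{(x_1,x_2)\in\Lambda_1\oplus\Lambda_2 : g_1(x_1)u=g_2(x_2)\}, \] a left $\Lambda$-module via $a\cdot(x_1,x_2)=(\pi_1(a)x_1,\pi_2(a)x_2)$; it is a locally free $\Lambda$-lattice of rank $1$. Let $\partial\colon\overline{\Lambda}^{\times}\to\mathrm{Cl}(\Lambda)$, $\partial(u)=[M(u)]_{\mathrm{st}}$, let $\ker(\partial)=\{u\in\overline{\Lambda}^{\times} : \partial(u)=[\Lambda]_{\mathrm{st}}\}$,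 and let $W=\{w_1w_2 : w_i\in g_i(\Lambda_i^{\times}),\ i=1,2\}\subseteq\overline{\Lambda}^{\times}$. Then $\Lambda$ has SFC if and only if both $\Lambda_1$ and $\Lambda_2$ have SFC and $W=\ker(\partial)$. -/

import Mathlib

open scoped TensorProduct

universe u v

section Orders

variable (R : Type*) (K : Type*) (A : Type*) [CommRing R] [Field K] [Ring A]
  [Algebra R K] [Algebra K A] [Algebra R A]

/-- An `R`-order in the `K`-algebra `A`: a subring of `A` (closed under the action of `R`) that is
finitely generated as an `R`-module and spans `A` over `K`. -/
structure ROrder extends Subalgebra R A where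
  /-- The order is finitely generated as an `R`-module. -/
  finite' : Module.Finite R toSubalgebra
  /-- The order spans the whole algebra over `K`. -/
  span_eq_top' : Submodule.span K (toSubalgebra : Set A) = ⊤

instance ROrder.instCoeSort : CoeSort (ROrder R K A) (Type _) :=
  ⟨fun Λ => Λ.toSubalgebra⟩

variable {R K A}

instance ROrder.instFinite (Λ : ROrder R K A) : Module.Finite R Λ := Λ.finite'

instance ROrder.instIsTorsionFree [IsDomain R] [IsFractionRing R K] [IsScalarTower R K A]
    (Λ : ROrder R K A) : Module.IsTorsionFree R Λ := by
  have : FaithfulSMul R K := (faithfulSMul_iff_algebraMap_injective R K).2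
    (IsFractionRing.injective R K)
  have : Module.IsTorsionFree R A := Module.IsTorsionFree.trans_faithfulSMul R K A
  infer_instance

end Orders

section Cancellation

/-- Stably free cancellation for a ring `Λ`. Every finitely generated (left) `Λ`-module is isomorphic
to one in the universe of `Λ`. -/
def HasSFC (Λ : Type u) [Ring Λ] : Prop :=
  ∀ (X : Type u) [AddCommGroup X] [Module Λ X] [Module.Finite Λ X] (m n : ℕ),
    Nonempty ((X × (Fin m → Λ)) ≃ₗ[Λ] (Fin (m + n) → Λ)) → Nonempty (X ≃ₗ[Λ] (Fin n → Λ))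

/-- `X` and `Y` are stably isomorphic: `X ⊕ Λ^m ≅ Y ⊕ Λ^m` for some `m`. -/
def StablyIsomorphic (Λ : Type*) [Ring Λ] (X Y : Type*) [AddCommGroup X] [AddCommGroup Y]
    [Module Λ X] [Module Λ Y] : Prop :=
  ∃ m : ℕ, Nonempty ((X × (Fin m → Λ)) ≃ₗ[Λ] (Y × (Fin m → Λ)))

/-- `X` and `Y` are locally isomorphic: `X_𝔭 ≅ Y_𝔭` over `Λ_𝔭` for every maximal ideal `𝔭` of `R`.
Here `X_𝔭 = X ⊗ R_𝔭`, on which `Λ` acts through the first factor; a `Λ`-linear map `X_𝔭 → Y_𝔭` is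
`R`-linear, hence automatically `R_𝔭`-linear and so `Λ_𝔭`-linear. -/
def LocallyIsomorphic (R : Type*) [CommRing R] (Λ : Type*) [Ring Λ] [Algebra R Λ]
    (X Y : Type*) [AddCommGroup X] [AddCommGroup Y] [Module R X] [Module R Y]
    [Module Λ X] [Module Λ Y] [IsScalarTower R Λ X] [IsScalarTower R Λ Y] : Prop :=
  ∀ (p : Ideal R) [p.IsMaximal],
    Nonempty ((X ⊗[R] Localization.AtPrime p) ≃ₗ[Λ] (Y ⊗[R] Localization.AtPrime p))

/-- The principal genus `g(Λ)`: `Λ`-lattices (left `Λ`-modules that are finitely generated and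
torsion-free over `R`) that are locally isomorphic to `Λ`, i.e. locally free of rank one. -/
structure PrincipalGenus (R : Type v) [CommRing R] (Λ : Type u) [Ring Λ] [Algebra R Λ] where
  /-- The underlying type. -/
  carrier : Type u
  [addCommGroup : AddCommGroup carrier]
  [baseModule : Module R carrier]
  [module : Module Λ carrier]
  [isScalarTower : IsScalarTower R Λ carrier]
  finite : Module.Finite R carrier
  torsionFree : Module.IsTorsionFree R carrier
  locallyFree : LocallyIsomorphic R Λ carrier Λ

attribute [instance] PrincipalGenus.addCommGroup PrincipalGenus.baseModule PrincipalGenus.module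
  PrincipalGenus.isScalarTower

theorem StablyIsomorphic.refl (Λ : Type*) [Ring Λ] (X : Type*) [AddCommGroup X] [Module Λ X] :
    StablyIsomorphic Λ X X := ⟨0, ⟨LinearEquiv.refl _ _⟩⟩

theorem StablyIsomorphic.symm {Λ : Type*} [Ring Λ] {X Y : Type*} [AddCommGroup X] [AddCommGroup Y]
    [Module Λ X] [Module Λ Y] (h : StablyIsomorphic Λ X Y) : StablyIsomorphic Λ Y X := by
  obtain ⟨m, ⟨e⟩⟩ := h
  exact ⟨m, ⟨e.symm⟩⟩

/-- If `X ⊕ Λ^m ≅ Y ⊕ Λ^m`, then `X ⊕ Λ^(m+k) ≅ Y ⊕ Λ^(m+k)`. -/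
theorem StablyIsomorphic.add_right {Λ : Type*} [Ring Λ] {X Y : Type*} [AddCommGroup X]
    [AddCommGroup Y] [Module Λ X] [Module Λ Y] {m : ℕ}
    (e : (X × (Fin m → Λ)) ≃ₗ[Λ] (Y × (Fin m → Λ))) (k : ℕ) :
    Nonempty ((X × (Fin (m + k) → Λ)) ≃ₗ[Λ] (Y × (Fin (m + k) → Λ))) := by
  let s : (Fin (m + k) → Λ) ≃ₗ[Λ] ((Fin m → Λ) × (Fin k → Λ)) :=
    (LinearEquiv.funCongrLeft Λ Λ finSumFinEquiv).trans
      (LinearEquiv.sumArrowLequivProdArrow (Fin m) (Fin k) Λ Λ)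
  let t (Z : Type _) [AddCommGroup Z] [Module Λ Z] :
      (Z × (Fin (m + k) → Λ)) ≃ₗ[Λ] ((Z × (Fin m → Λ)) × (Fin k → Λ)) :=
    ((LinearEquiv.refl Λ Z).prodCongr s).trans (LinearEquiv.prodAssoc Λ Z _ _).symm
  let t' (Z : Type _) [AddCommGroup Z] [Module Λ Z] :
      (Z × (Fin (m + k) → Λ)) ≃ₗ[Λ] ((Z × (Fin m → Λ)) × (Fin k → Λ)) :=
    ((LinearEquiv.refl Λ Z).prodCongr s).trans (LinearEquiv.prodAssoc Λ Z _ _).symm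
  exact ⟨(t X).trans ((e.prodCongr (LinearEquiv.refl Λ _)).trans (t' Y).symm)⟩

theorem StablyIsomorphic.trans {Λ : Type*} [Ring Λ] {X Y Z : Type*} [AddCommGroup X]
    [AddCommGroup Y] [AddCommGroup Z] [Module Λ X] [Module Λ Y] [Module Λ Z]
    (h : StablyIsomorphic Λ X Y) (h' : StablyIsomorphic Λ Y Z) : StablyIsomorphic Λ X Z := by
  obtain ⟨m, ⟨e⟩⟩ := h
  obtain ⟨n, ⟨e'⟩⟩ := h'
  obtain ⟨a⟩ := StablyIsomorphic.add_right e n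
  obtain ⟨b⟩ := StablyIsomorphic.add_right e' m
  rw [Nat.add_comm n m] at b
  exact ⟨m + n, ⟨a.trans b⟩⟩

variable (R : Type v) [CommRing R] (Λ : Type u) [Ring Λ] [Algebra R Λ]

/-- Stable isomorphism as an equivalence relation on the principal genus. -/
instance PrincipalGenus.setoid : Setoid (PrincipalGenus R Λ) where
  r X Y := StablyIsomorphic Λ X.carrier Y.carrier
  iseqv := ⟨fun _ => StablyIsomorphic.refl _ _, StablyIsomorphic.symm, StablyIsomorphic.trans⟩

/-- The free module of rank one as a member of the principal genus. -/
def PrincipalGenus.self [Module.Finite R Λ] [Module.IsTorsionFree R Λ] : PrincipalGenus R Λ where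
  carrier := Λ
  finite := inferInstance
  torsionFree := inferInstance
  locallyFree := fun _ _ => ⟨LinearEquiv.refl _ _⟩

/-- The (set underlying the) locally free class group `Cl(Λ)`: the stable isomorphism classes
`[X]_st` of the members `X` of the principal genus. -/
def LFClassGroup : Type (max (u + 1) v) := Quotient (PrincipalGenus.setoid R Λ)

/-- The stable class `[X]_st` in `Cl(Λ)`. -/
def PrincipalGenus.stableClass {R : Type v} [CommRing R] {Λ : Type u} [Ring Λ] [Algebra R Λ]
    (X : PrincipalGenus R Λ) : LFClassGroup R Λ := Quotient.mk _ X

/-- The identity element of `Cl(Λ)` is the class `[Λ]_st`. -/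
instance LFClassGroup.instZero [Module.Finite R Λ] [Module.IsTorsionFree R Λ] :
    Zero (LFClassGroup R Λ) := ⟨(PrincipalGenus.self R Λ).stableClass⟩

end Cancellation

section UnitLifting

/-- In a ring that is Artinian and Noetherian as a left module, an element that is regular modulo a
kernel can be changed by an element of the kernel to become a unit. -/
theorem exists_isUnit_add_of_map_isUnit {B C : Type*} [Ring B] [Ring C] [IsArtinian B B]
    [IsNoetherian B B] (f : B →+* C) (b : B) (hb : IsUnit (f b)) :
    ∃ i, f i = 0 ∧ IsUnit (b + i) := by
  let ρ : Module.End B B := LinearMap.toSpanSingleton B B b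
  have hρ : ∀ (n : ℕ) (x : B), (ρ ^ n) x = x * b ^ n := by
    intro n
    induction n with
    | zero => simp
    | succ n ih => intro x; rw [pow_succ', Module.End.mul_apply, ih]; simp [ρ, pow_succ, mul_assoc]
  obtain ⟨n, hn, hn1⟩ := (ρ.eventually_isCompl_ker_pow_range_pow.and
    (Filter.eventually_ge_atTop 1)).exists
  have h1 : (1 : B) ∈ LinearMap.ker (ρ ^ n) ⊔ LinearMap.range (ρ ^ n) := by
    rw [hn.sup_eq_top]; trivial
  obtain ⟨e, he, d, hd, hed⟩ := Submodule.mem_sup.1 h1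
  have heb : e * b ^ n = 0 := by rw [← hρ]; exact he
  have hfe : f e = 0 := by
    have h := congrArg f heb
    rw [map_mul, map_pow, map_zero] at h
    exact ((hb.pow n).mul_left_eq_zero).1 h
  -- right multiplication by `e + d * b` is injective
  have hinj : Function.Injective (LinearMap.toSpanSingleton B B (b + (e - e * b))) := by
    rw [← LinearMap.ker_eq_bot, LinearMap.ker_eq_bot']
    intro x hx
    have hd' : d = 1 - e := by rw [← hed]; abel
    have hx' : x * e + (x * d) * b = 0 := by
      simp only [LinearMap.toSpanSingleton_apply, smul_eq_mul] at hx
      rw [hd', ← hx]; noncomm_ring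
    have hxe : x * e ∈ LinearMap.ker (ρ ^ n) := (LinearMap.ker (ρ ^ n)).smul_mem x he
    have hxd : x * d ∈ LinearMap.range (ρ ^ n) := (LinearMap.range (ρ ^ n)).smul_mem x hd
    have hxdb : (x * d) * b ∈ LinearMap.range (ρ ^ n) := by
      obtain ⟨y, hy⟩ := hxd
      refine ⟨y * b, ?_⟩
      rw [← hy, hρ, hρ, mul_assoc, mul_assoc, ← pow_succ, ← pow_succ']
    have hxe0 : x * e = 0 := by
      have : x * e ∈ LinearMap.range (ρ ^ n) := by
        rw [eq_neg_of_add_eq_zero_left hx']; exact neg_mem hxdb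
      exact (Submodule.disjoint_def.1 hn.disjoint) _ hxe this
    have hxd0 : x * d = 0 := by
      rw [hxe0, zero_add] at hx'
      refine (Submodule.disjoint_def.1 hn.disjoint) _ ?_ hxd
      rw [LinearMap.mem_ker, hρ]
      obtain ⟨k, rfl⟩ := Nat.exists_eq_add_of_le' hn1
      rw [pow_succ', ← mul_assoc, hx', zero_mul]
    rw [← mul_one x, ← hed, mul_add, hxe0, hxd0, add_zero]
  refine ⟨e - e * b, by rw [map_sub, map_mul, hfe, zero_mul, sub_zero], ?_⟩
  obtain ⟨y, hy⟩ := IsArtinian.surjective_of_injective_endomorphism _ hinj 1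
  simp only [LinearMap.toSpanSingleton_apply, smul_eq_mul] at hy
  refine ⟨⟨_, y, hinj ?_, hy⟩, rfl⟩
  simp only [LinearMap.toSpanSingleton_apply, smul_eq_mul]
  rw [mul_assoc, hy, mul_one, one_mul]

/-- A linear map that is surjective modulo `p` is surjective up to a scalar outside `p`. -/
theorem exists_smul_mem_range_of_mod_maximal {R M : Type*} [CommRing R] [AddCommGroup M]
    [Module R M] [Module.Finite R M] (p : Ideal R) [hp : p.IsMaximal] (L : M →ₗ[R] M)
    (h : ∀ x, ∃ y, x - L y ∈ p • (⊤ : Submodule R M)) :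
    ∃ s, s ∉ p ∧ ∀ x, ∃ y, L y = s • x := by
  obtain ⟨s, hs, hs'⟩ := Submodule.exists_sub_one_mem_and_smul_eq_zero_of_fg_of_le_smul p
    (⊤ : Submodule R (M ⧸ LinearMap.range L)) Module.Finite.fg_top (by
      intro q _
      obtain ⟨x, rfl⟩ := Submodule.Quotient.mk_surjective _ q
      obtain ⟨y, hy⟩ := h x
      have h1 : (LinearMap.range L).mkQ (x - L y) ∈
          (p • (⊤ : Submodule R M)).map (LinearMap.range L).mkQ := Submodule.mem_map_of_mem hy
      rw [Submodule.map_smul'', Submodule.map_top, Submodule.range_mkQ] at h1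
      have h2 : (LinearMap.range L).mkQ (L y) = 0 := by simp
      rwa [map_sub, h2, sub_zero] at h1)
  refine ⟨s, fun hsp => hp.ne_top ((Ideal.eq_top_iff_one p).2 ?_), fun x => ?_⟩
  · simpa using sub_mem hsp hs
  · have := hs' (Submodule.Quotient.mk x) trivial
    rw [← Submodule.Quotient.mk_smul, Submodule.Quotient.mk_eq_zero] at this
    exact this

/-- Units lift along surjections of `R`-algebras, locally at a maximal ideal `p`. -/
theorem exists_local_unit_lift {R Γ C : Type*} [CommRing R] [Ring Γ] [Algebra R Γ]
    [Module.Finite R Γ] [Ring C] [Algebra R C] (g : Γ →ₐ[R] C) (hg : Function.Surjective g)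
    (u : Cˣ) (p : Ideal R) [hp : p.IsMaximal] :
    ∃ v w : Γ, ∃ s : R, s ∉ p ∧ g v = u ∧ w * v = algebraMap R Γ s ∧ v * w = algebraMap R Γ s := by
  let : Field (R ⧸ p) := Ideal.Quotient.field p
  have : IsArtinianRing ((R ⧸ p) ⊗[R] Γ) := IsArtinianRing.of_finite (R ⧸ p) _
  have hsurj : ∀ (N : Type _) [AddCommGroup N] [Module R N],
      Function.Surjective (TensorProduct.mk R (R ⧸ p) N 1) := fun N _ _ =>
    TensorProduct.mk_surjective R N (R ⧸ p) Ideal.Quotient.mk_surjective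
  let f : (R ⧸ p) ⊗[R] Γ →ₐ[R ⧸ p] (R ⧸ p) ⊗[R] C :=
    Algebra.TensorProduct.map (AlgHom.id (R ⧸ p) (R ⧸ p)) g
  obtain ⟨v₀, hv₀⟩ := hg u
  obtain ⟨i, hi, hu⟩ := exists_isUnit_add_of_map_isUnit (f : (R ⧸ p) ⊗[R] Γ →+* (R ⧸ p) ⊗[R] C)
    (1 ⊗ₜ v₀) (by
      have : f (1 ⊗ₜ v₀) = Algebra.TensorProduct.includeRight (R := R) (A := R ⧸ p) (u : C) := by
        simp [f, hv₀]
      rw [RingHom.coe_coe, this]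
      exact u.isUnit.map _)
  have hex := lTensor_exact (R ⧸ p) (LinearMap.exact_subtype_ker_map g.toLinearMap) hg
  obtain ⟨z, hz⟩ := (hex i).1 (by
    have : ∀ k, (LinearMap.lTensor (R ⧸ p) g.toLinearMap) k = f k := by
      intro k
      induction k using TensorProduct.induction_on with
      | zero => simp
      | tmul a b => simp [f]
      | add a b ha hb => rw [map_add, map_add, ha, hb]
    rw [this]; exact hi)
  obtain ⟨j, rfl⟩ := hsurj _ z
  have hvi : (1 : R ⧸ p) ⊗ₜ[R] v₀ + i = 1 ⊗ₜ (v₀ + j) := by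
    rw [← hz, TensorProduct.tmul_add]; simp
  rw [hvi] at hu
  have hgv : g (v₀ + j) = u := by
    have : g j = 0 := j.2
    rw [map_add, this, add_zero, hv₀]
  generalize v₀ + (j : Γ) = v at hu hgv
  obtain ⟨⟨_, c, hvc, hcv⟩, rfl⟩ := hu
  obtain ⟨w₀, rfl⟩ := hsurj _ c
  have key : ∀ x : Γ, (1 : R ⧸ p) ⊗ₜ[R] x = 1 → 1 - x ∈ p • (⊤ : Submodule R Γ) := by
    intro x hx
    rw [← Submodule.Quotient.mk_eq_zero, ← TensorProduct.quotTensorEquivQuotSMul_mk_one_tmul,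
      TensorProduct.tmul_sub, hx, Algebra.TensorProduct.one_def, sub_self, map_zero]
  have h1 := key (v * w₀) (by simpa using hvc)
  have h2 := key (w₀ * v) (by simpa using hcv)
  have hmul : ∀ x y : Γ, y ∈ p • (⊤ : Submodule R Γ) →
      x * y ∈ p • (⊤ : Submodule R Γ) ∧ y * x ∈ p • (⊤ : Submodule R Γ) := by
    intro x y hy
    constructor
    · have := Submodule.mem_map_of_mem (f := LinearMap.mulLeft R x) hy
      rw [Submodule.map_smul''] at this
      exact Submodule.smul_mono le_rfl le_top this
    · have := Submodule.mem_map_of_mem (f := LinearMap.mulRight R x) hy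
      rw [Submodule.map_smul''] at this
      exact Submodule.smul_mono le_rfl le_top this
  obtain ⟨s, hs, hs'⟩ := exists_smul_mem_range_of_mod_maximal p (LinearMap.mulRight R v)
    (fun x => ⟨x * w₀, by
      have := (hmul x _ h2).1
      rwa [mul_sub, mul_one, ← mul_assoc] at this⟩)
  obtain ⟨t, ht, ht'⟩ := exists_smul_mem_range_of_mod_maximal p (LinearMap.mulLeft R v)
    (fun x => ⟨w₀ * x, by
      have := (hmul x _ h1).2
      rwa [sub_mul, one_mul, mul_assoc] at this⟩)
  obtain ⟨a, ha⟩ := hs' 1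
  obtain ⟨b, hb⟩ := ht' 1
  rw [LinearMap.mulRight_apply] at ha
  rw [LinearMap.mulLeft_apply] at hb
  have hab : t • a = s • b := by
    calc t • a = a * (t • 1) := by simp
      _ = (a * v) * b := by rw [← hb, mul_assoc]
      _ = s • b := by rw [ha]; simp
  refine ⟨v, t • a, t * s, fun h => (hp.isPrime.mem_or_mem h).elim ht hs, hgv, ?_, ?_⟩
  · rw [smul_mul_assoc, ha, smul_smul, Algebra.algebraMap_eq_smul_one]
  · rw [hab, mul_smul_comm, hb, smul_smul, mul_comm, Algebra.algebraMap_eq_smul_one]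

end UnitLifting

section FibreProducts

/-- A fibre product (pullback square) of `R`-algebras
`Λ → Λ₁ → Λbar`, `Λ → Λ₂ → Λbar`. -/
structure FibreProduct (R : Type*) [CommRing R] (Λ Λ₁ Λ₂ Λbar : Type*) [Ring Λ] [Ring Λ₁] [Ring Λ₂]
    [Ring Λbar] [Algebra R Λ] [Algebra R Λ₁] [Algebra R Λ₂] [Algebra R Λbar] where
  /-- The projection to the first factor. -/
  π₁ : Λ →ₐ[R] Λ₁
  /-- The projection to the second factor. -/
  π₂ : Λ →ₐ[R] Λ₂
  /-- The map from the first factor to the base. -/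
  g₁ : Λ₁ →ₐ[R] Λbar
  /-- The map from the second factor to the base. -/
  g₂ : Λ₂ →ₐ[R] Λbar
  comm : ∀ x, g₁ (π₁ x) = g₂ (π₂ x)
  existsUnique : ∀ x₁ x₂, g₁ x₁ = g₂ x₂ → ∃! x, π₁ x = x₁ ∧ π₂ x = x₂

namespace FibreProduct

variable {R : Type*} [CommRing R] {Λ Λ₁ Λ₂ Λbar : Type*} [Ring Λ] [Ring Λ₁] [Ring Λ₂]
    [Ring Λbar] [Algebra R Λ] [Algebra R Λ₁] [Algebra R Λ₂] [Algebra R Λbar]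

/-- The subset `W = g₁(Λ₁ˣ) g₂(Λ₂ˣ)` of `Λbarˣ`. -/
def W (D : FibreProduct R Λ Λ₁ Λ₂ Λbar) : Set Λbarˣ :=
  {w | ∃ (a : Λ₁ˣ) (b : Λ₂ˣ), w = Units.map (D.g₁ : Λ₁ →* Λbar) a * Units.map (D.g₂ : Λ₂ →* Λbar) b}

/-- The set `M(u) = {(x₁, x₂) ∈ Λ₁ ⊕ Λ₂ : g₁(x₁) u = g₂(x₂)}`, as an `R`-submodule. -/
def submoduleM (D : FibreProduct R Λ Λ₁ Λ₂ Λbar) (u : Λbarˣ) : Submodule R (Λ₁ × Λ₂) where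
  carrier := {x | D.g₁ x.1 * u = D.g₂ x.2}
  add_mem' := by
    intro x y hx hy
    simp only [Set.mem_ofPred_eq, Prod.fst_add, Prod.snd_add, map_add, add_mul] at *
    rw [hx, hy]
  zero_mem' := by simp
  smul_mem' := by
    intro r x hx
    simp only [Set.mem_ofPred_eq, Prod.smul_fst, Prod.smul_snd, map_smul, smul_mul_assoc] at *
    rw [hx]

/-- The `Λ`-module `M(u)`. -/
def M (D : FibreProduct R Λ Λ₁ Λ₂ Λbar) (u : Λbarˣ) : Type _ := D.submoduleM u

variable (D : FibreProduct R Λ Λ₁ Λ₂ Λbar) (u : Λbarˣ)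

instance : AddCommGroup (D.M u) := inferInstanceAs (AddCommGroup (D.submoduleM u))

instance : Module R (D.M u) := inferInstanceAs (Module R (D.submoduleM u))

theorem M_mem (x : D.M u) : D.g₁ x.1.1 * u = D.g₂ x.1.2 := x.2

/-- `Λ` acts on `M(u)` by `a • (x₁, x₂) = (π₁(a) x₁, π₂(a) x₂)`. -/
instance : Module Λ (D.M u) where
  smul a x := ⟨(D.π₁ a * x.1.1, D.π₂ a * x.1.2), by
    change D.g₁ (D.π₁ a * x.1.1) * u = D.g₂ (D.π₂ a * x.1.2)
    rw [map_mul, map_mul, mul_assoc, D.M_mem u x, D.comm]⟩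
  one_smul x := Subtype.ext (Prod.ext (by change D.π₁ 1 * _ = _; simp)
    (by change D.π₂ 1 * _ = _; simp))
  mul_smul a b x := Subtype.ext (Prod.ext
    (by change D.π₁ (a * b) * _ = D.π₁ a * (D.π₁ b * _); simp [mul_assoc])
    (by change D.π₂ (a * b) * _ = D.π₂ a * (D.π₂ b * _); simp [mul_assoc]))
  smul_zero a := Subtype.ext (Prod.ext (mul_zero _) (mul_zero _))
  smul_add a x y := Subtype.ext (Prod.ext (mul_add _ _ _) (mul_add _ _ _))
  add_smul a b x := Subtype.ext (Prod.ext
    (by change D.π₁ (a + b) * _ = D.π₁ a * _ + D.π₁ b * _; simp [add_mul])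
    (by change D.π₂ (a + b) * _ = D.π₂ a * _ + D.π₂ b * _; simp [add_mul]))
  zero_smul x := Subtype.ext (Prod.ext (by change D.π₁ 0 * _ = 0; simp)
    (by change D.π₂ 0 * _ = 0; simp))

theorem smul_val (a : Λ) (x : D.M u) :
    (a • x).1 = (D.π₁ a * x.1.1, D.π₂ a * x.1.2) := rfl

instance : IsScalarTower R Λ (D.M u) where
  smul_assoc r a x := Subtype.ext (Prod.ext
    (by change D.π₁ (r • a) * _ = r • (D.π₁ a * _); simp)
    (by change D.π₂ (r • a) * _ = r • (D.π₂ a * _); simp))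

instance [IsNoetherianRing R] [Module.Finite R Λ₁] [Module.Finite R Λ₂] :
    Module.Finite R (D.M u) :=
  inferInstanceAs (Module.Finite R (D.submoduleM u))

instance [Module.IsTorsionFree R Λ₁] [Module.IsTorsionFree R Λ₂] :
    Module.IsTorsionFree R (D.M u) :=
  inferInstanceAs (Module.IsTorsionFree R (D.submoduleM u))

/-- The element of `Λ` with given compatible components. -/
noncomputable def lift (x₁ : Λ₁) (x₂ : Λ₂) (h : D.g₁ x₁ = D.g₂ x₂) : Λ :=
  (D.existsUnique x₁ x₂ h).choose

theorem π₁_lift (x₁ : Λ₁) (x₂ : Λ₂) (h : D.g₁ x₁ = D.g₂ x₂) : D.π₁ (D.lift x₁ x₂ h) = x₁ :=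
  (D.existsUnique x₁ x₂ h).choose_spec.1.1

theorem π₂_lift (x₁ : Λ₁) (x₂ : Λ₂) (h : D.g₁ x₁ = D.g₂ x₂) : D.π₂ (D.lift x₁ x₂ h) = x₂ :=
  (D.existsUnique x₁ x₂ h).choose_spec.1.2

theorem hom_ext {x y : Λ} (h₁ : D.π₁ x = D.π₁ y) (h₂ : D.π₂ x = D.π₂ y) : x = y :=
  (D.existsUnique (D.π₁ y) (D.π₂ y) (D.comm y)).unique ⟨h₁, h₂⟩ ⟨rfl, rfl⟩

/-- Two `Λ`-linear maps that are mutually inverse up to a scalar outside `p` yield an isomorphism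
of the localisations at `p`. -/
theorem localEquiv {X Y : Type*} [AddCommGroup X] [AddCommGroup Y] [Module R X]
    [Module R Y] [Module Λ X] [Module Λ Y] [IsScalarTower R Λ X] [IsScalarTower R Λ Y]
    (p : Ideal R) [p.IsPrime] (s : R) (hs : s ∉ p) (f : X →ₗ[Λ] Y) (h : Y →ₗ[Λ] X)
    (hf : ∀ x, h (f x) = s • x) (hh : ∀ y, f (h y) = s • y) :
    Nonempty ((X ⊗[R] Localization.AtPrime p) ≃ₗ[Λ] (Y ⊗[R] Localization.AtPrime p)) := by
  let c : Localization.AtPrime p := Localization.mk 1 ⟨s, hs⟩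
  have hc : s • c = 1 := by
    simp only [c]
    rw [Localization.smul_mk, smul_eq_mul, mul_one]
    exact Localization.mk_self (⟨s, hs⟩ : p.primeCompl)
  have hcz : ∀ z : Localization.AtPrime p, s • (c * z) = z := fun z => by
    rw [← smul_mul_assoc, hc, one_mul]
  refine ⟨LinearEquiv.ofLinearMap
    (TensorProduct.AlgebraTensorModule.map f (LinearMap.id (R := R)))
    (TensorProduct.AlgebraTensorModule.map h (LinearMap.mulLeft R c)) ?_ ?_⟩
  · apply TensorProduct.AlgebraTensorModule.ext
    intro y z
    simp [hh, TensorProduct.smul_tmul, hcz]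
  · apply TensorProduct.AlgebraTensorModule.ext
    intro y z
    simp [hf, TensorProduct.smul_tmul, hcz]

/-- `M(u)` is locally free of rank one if `g₁` or `g₂` is surjective. -/
theorem M_locallyFree [Module.Finite R Λ₁] [Module.Finite R Λ₂]
    (hg : Function.Surjective D.g₁ ∨ Function.Surjective D.g₂) :
    LocallyIsomorphic R Λ (D.M u) Λ := by
  intro p hp
  rcases hg with hg | hg
  · obtain ⟨v, w, s, hs, hgv, hwv, hvw⟩ := exists_local_unit_lift D.g₁ hg u⁻¹ p
    have hm : ((v, 1) : Λ₁ × Λ₂) ∈ D.submoduleM u := by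
      change D.g₁ v * u = D.g₂ 1
      rw [hgv, map_one, Units.inv_mul]
    have hcomp : ∀ x : D.M u, D.g₁ (x.1.1 * w) = D.g₂ (s • x.1.2) := by
      intro x
      have h1 : D.g₁ w = s • (u : Λbar) := by
        have h2 := congrArg D.g₁ hwv
        rw [map_mul, hgv, AlgHom.commutes] at h2
        rw [← mul_one (D.g₁ w), ← Units.inv_mul u, ← mul_assoc, h2, Algebra.smul_def]
      rw [map_mul, h1, mul_smul_comm, D.M_mem u x, map_smul]
    let m : D.M u := ⟨(v, 1), hm⟩
    let h : D.M u →ₗ[Λ] Λ :=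
      { toFun := fun x => D.lift _ _ (hcomp x)
        map_add' := fun x y => D.hom_ext
          (by rw [map_add, π₁_lift, π₁_lift, π₁_lift]; exact add_mul _ _ _)
          (by rw [map_add, π₂_lift, π₂_lift, π₂_lift]; exact smul_add _ _ _)
        map_smul' := fun a x => D.hom_ext
          (by rw [RingHom.id_apply, smul_eq_mul, map_mul, π₁_lift, π₁_lift]; exact mul_assoc _ _ _)
          (by rw [RingHom.id_apply, smul_eq_mul, map_mul, π₂_lift, π₂_lift, mul_smul_comm]; rfl) }
    refine localEquiv p s hs h (LinearMap.toSpanSingleton Λ _ m) ?_ ?_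
    · intro x
      refine Subtype.ext (Prod.ext ?_ ?_)
      · change D.π₁ (D.lift _ _ (hcomp x)) * v = s • x.1.1
        rw [π₁_lift, mul_assoc, hwv, ← Algebra.commutes, Algebra.smul_def]
      · change D.π₂ (D.lift _ _ (hcomp x)) * 1 = s • x.1.2
        rw [π₂_lift, mul_one]
    · intro a
      refine D.hom_ext ?_ ?_
      · change D.π₁ (D.lift _ _ (hcomp (a • m))) = _
        rw [π₁_lift, map_smul]
        change D.π₁ a * v * w = _
        rw [mul_assoc, hvw, ← Algebra.commutes, Algebra.smul_def]
      · change D.π₂ (D.lift _ _ (hcomp (a • m))) = _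
        rw [π₂_lift, map_smul]
        change s • (D.π₂ a * 1) = _
        rw [mul_one]
  · obtain ⟨v, w, s, hs, hgv, hwv, hvw⟩ := exists_local_unit_lift D.g₂ hg u p
    have hm : ((1, v) : Λ₁ × Λ₂) ∈ D.submoduleM u := by
      change D.g₁ 1 * u = D.g₂ v
      rw [hgv, map_one, one_mul]
    have hcomp : ∀ x : D.M u, D.g₁ (s • x.1.1) = D.g₂ (x.1.2 * w) := by
      intro x
      have h2 := congrArg D.g₂ hvw
      rw [map_mul, hgv, AlgHom.commutes] at h2
      rw [map_mul, ← D.M_mem u x, mul_assoc, h2, map_smul, ← Algebra.commutes, Algebra.smul_def]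
    let m : D.M u := ⟨(1, v), hm⟩
    let h : D.M u →ₗ[Λ] Λ :=
      { toFun := fun x => D.lift _ _ (hcomp x)
        map_add' := fun x y => D.hom_ext
          (by rw [map_add, π₁_lift, π₁_lift, π₁_lift]; exact smul_add _ _ _)
          (by rw [map_add, π₂_lift, π₂_lift, π₂_lift]; exact add_mul _ _ _)
        map_smul' := fun a x => D.hom_ext
          (by rw [RingHom.id_apply, smul_eq_mul, map_mul, π₁_lift, π₁_lift, mul_smul_comm]; rfl)
          (by rw [RingHom.id_apply, smul_eq_mul, map_mul, π₂_lift, π₂_lift]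
              exact mul_assoc _ _ _) }
    refine localEquiv p s hs h (LinearMap.toSpanSingleton Λ _ m) ?_ ?_
    · intro x
      refine Subtype.ext (Prod.ext ?_ ?_)
      · change D.π₁ (D.lift _ _ (hcomp x)) * 1 = s • x.1.1
        rw [π₁_lift, mul_one]
      · change D.π₂ (D.lift _ _ (hcomp x)) * v = s • x.1.2
        rw [π₂_lift, mul_assoc, hwv, ← Algebra.commutes, Algebra.smul_def]
    · intro a
      refine D.hom_ext ?_ ?_
      · change D.π₁ (D.lift _ _ (hcomp (a • m))) = _
        rw [π₁_lift, map_smul]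
        change s • (D.π₁ a * 1) = _
        rw [mul_one]
      · change D.π₂ (D.lift _ _ (hcomp (a • m))) = _
        rw [π₂_lift, map_smul]
        change D.π₂ a * v * w = _
        rw [mul_assoc, hvw, ← Algebra.commutes, Algebra.smul_def]

end FibreProduct

namespace FibreProduct

variable {R : Type v} [CommRing R] [IsNoetherianRing R] {Λ Λ₁ Λ₂ : Type u} {Λbar : Type*} [Ring Λ]
    [Ring Λ₁] [Ring Λ₂] [Ring Λbar] [Algebra R Λ] [Algebra R Λ₁] [Algebra R Λ₂] [Algebra R Λbar]
    [Module.Finite R Λ₁] [Module.Finite R Λ₂]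
    [Module.IsTorsionFree R Λ₁] [Module.IsTorsionFree R Λ₂]

/-- `M(u)` as a member of the principal genus of `Λ`. -/
def genusM (D : FibreProduct R Λ Λ₁ Λ₂ Λbar)
    (hg : Function.Surjective D.g₁ ∨ Function.Surjective D.g₂) (u : Λbarˣ) :
    PrincipalGenus R Λ where
  carrier := D.M u
  finite := inferInstance
  torsionFree := inferInstance
  locallyFree := D.M_locallyFree u hg

/-- The map `∂ : Λbarˣ → Cl(Λ)`, `∂(u) = [M(u)]_st`. -/
def boundary (D : FibreProduct R Λ Λ₁ Λ₂ Λbar)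
    (hg : Function.Surjective D.g₁ ∨ Function.Surjective D.g₂) (u : Λbarˣ) :
    LFClassGroup R Λ :=
  (D.genusM hg u).stableClass

/-- The kernel of `∂`: the units that `∂` sends to the identity element of `Cl(Λ)`. -/
def kerBoundary [Module.Finite R Λ] [Module.IsTorsionFree R Λ]
    (D : FibreProduct R Λ Λ₁ Λ₂ Λbar)
    (hg : Function.Surjective D.g₁ ∨ Function.Surjective D.g₂) : Set Λbarˣ :=
  {u | D.boundary hg u = 0}

end FibreProduct

end FibreProducts

/-! For an order, stably free cancellation is a statement about rank two. Orders over a Dedekind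
domain have stable range at most two (`ROrder.exists_shorten`): shorten first over the semisimple
algebra, which leaves a nonzero scalar `r`, then over the artinian ring Λ/rΛ. Transvections
therefore carry any split functional on Λⁿ, n ≥ 3, to a coordinate, and Λ can be cancelled there.
What remains is cancellation from Λ² to Λ, which amounts to transitivity of GL₂(Λ) on unimodular
columns of length two; this is `ROrder.hasSFC_iff`.

That condition is studied by Milnor patching, with `g₂` surjective (otherwise the factors are
interchanged). The ring Λbar is then artinian, so over it elementary matrices already act
transitively, and they lift to Λ₂. Hence a unimodular column over a factor, in the case of Λ₂ after
an elementary change, extends to one over Λ, and transitivity descends from Λ to both factors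
(`transitive_fst`, `transitive_snd`). Conversely, matrices over Λ₁ and Λ₂ completing the images of
one column over Λ differ over Λbar by a matrix fixing the first basis vector, thus by diag(1, u) up
to an elementary matrix. Such a factorisation gives M(u) ⊕ Λ ≅ Λ² (`stablyIsomorphic_M`), so `u`
lies in ker ∂; if `u` lies in W, the two matrices can be corrected to agree and glue to a matrix
over Λ (`transitive_of_factors`).

Finally, M(u) is free exactly when `u` lies in W, so W ⊆ ker ∂ always holds, and cancellation over Λ
gives the reverse inclusion. -/

section StableRange

/-! ### Stable range of semisimple and artinian rings -/

/-- In a semisimple ring that is noetherian over a commutative ring `k`, a left unimodular pair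
`(a, b)` can be shortened to a unit `a + t * b`, with `t` in a given additively closed set that
contains an invertible multiple of every element. -/
theorem exists_isUnit_add_mul_of_isSemisimpleRing (k : Type*) {B : Type*} [CommRing k] [Ring B]
    [Algebra k B] [IsNoetherian k B] [IsSemisimpleRing B] (T : AddSubmonoid B)
    (hT : ∀ x : B, ∃ s : k, IsUnit s ∧ s • x ∈ T) {a b c d : B} (h : c * a + d * b = 1) :
    ∃ t ∈ T, IsUnit (a + t * b) := by
  -- Take `t` in `T` with the left ideal B(a + tb) maximal; then `a + t * b` is shown to be a unit,
  -- and is renamed `a`.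
  obtain ⟨_, ⟨t, ht, rfl⟩, hmax⟩ := set_has_maximal_iff_noetherian.2
    (inferInstance : IsNoetherian B B)
    ((fun t => Submodule.span B {a + t * b}) '' (T : Set B)) ⟨_, 0, T.zero_mem, rfl⟩
  refine ⟨t, ht, ?_⟩
  have h' : c * (a + t * b) + (d - c * t) * b = 1 := by rw [← h]; noncomm_ring
  have hmax' : ∀ x ∈ T, ¬ Submodule.span B {a + t * b} < Submodule.span B {a + t * b + x * b} := by
    intro x hx
    have := hmax _ ⟨t + x, T.add_mem ht hx, rfl⟩
    simpa only [add_mul, add_assoc] using this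
  generalize a + t * b = a at h' hmax'
  generalize d - c * t = d at h'
  clear hmax h
  -- By semisimplicity the left annihilator of `a` is Be with `e` idempotent, the component of 1 in
  -- it.
  obtain ⟨N', hN'⟩ := exists_isCompl (LinearMap.ker (LinearMap.toSpanSingleton B B a))
  obtain ⟨e, he, f, hf, hef⟩ := Submodule.mem_sup.1
    (show (1 : B) ∈ LinearMap.ker (LinearMap.toSpanSingleton B B a) ⊔ N' by
      rw [hN'.sup_eq_top]; trivial)
  have hN : ∀ x, x * a = 0 → x * e = x := by
    intro x hx
    have hxN : x ∈ LinearMap.ker (LinearMap.toSpanSingleton B B a) := hx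
    have h1 : x * f = x - x * e := by
      rw [eq_sub_iff_add_eq', ← mul_add, hef, mul_one]
    have h2 : x * f ∈ LinearMap.ker (LinearMap.toSpanSingleton B B a) := by
      rw [h1]; exact sub_mem hxN (Submodule.smul_mem _ x he)
    have h3 := (Submodule.disjoint_def.1 hN'.disjoint) _ h2 (N'.smul_mem x hf)
    rw [h1, sub_eq_zero] at h3
    exact h3.symm
  have hea : e * a = 0 := he
  have hee : e * e = e := hN e hea
  have hf1 : f = 1 - e := by rw [← hef]; abel
  -- This is eB ⊆ Ba. If `e * y` is not in Ba, neither is `e * y * d * b`. Adding an invertible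
  -- multiple of the latter to `a` strictly enlarges Ba, since multiplying by 1 - e recovers `a`.
  have hsub : ∀ y, ∃ z, e * y = z * a := by
    intro y
    by_contra hy
    obtain ⟨s, hs, hsT⟩ := hT (e * (y * d))
    have hy' : e * y = (e * y * c) * a + e * (y * d) * b := by
      conv_lhs => rw [← mul_one (e * y), ← h']
      noncomm_ring
    have hfa : f * (a + s • (e * (y * d)) * b) = a := by
      have : f * (s • (e * (y * d)) * b) = 0 := by
        rw [smul_mul_assoc, mul_smul_comm, hf1, mul_assoc, sub_mul, one_mul, ← mul_assoc e e, hee,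
          sub_self, smul_zero]
      rw [mul_add, this, add_zero, hf1, sub_mul, hea, one_mul, sub_zero]
    refine hmax' _ hsT (lt_of_le_of_ne ?_ fun heq => hy ?_)
    · rw [Submodule.span_singleton_le_iff_mem, Submodule.mem_span_singleton]
      exact ⟨f, hfa⟩
    · have h1 : a + s • (e * (y * d)) * b ∈ Submodule.span B {a} := by
        rw [heq]; exact Submodule.mem_span_singleton_self _
      have h2 : s • (e * (y * d) * b) ∈ Submodule.span B {a} := by
        rw [← smul_mul_assoc]
        simpa using sub_mem h1 (Submodule.mem_span_singleton_self a)
      have h3 : e * (y * d) * b ∈ Submodule.span B {a} := by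
        obtain ⟨s, rfl⟩ := hs
        have h3 := Submodule.smul_mem (Submodule.span B {a}) (algebraMap k B ↑s⁻¹) h2
        rwa [smul_eq_mul, ← Algebra.smul_def, smul_smul, Units.inv_mul, one_smul] at h3
      have h4 : e * y ∈ Submodule.span B {a} := by
        rw [hy']
        exact add_mem (Submodule.mem_span_singleton.2 ⟨_, rfl⟩) h3
      obtain ⟨z, hz⟩ := Submodule.mem_span_singleton.1 h4
      exact ⟨z, hz.symm⟩
  -- Right multiplication by `a` maps eB onto itself, hence is injective by noetherianity over `k`;
  -- but it kills `e`.
  have he0 : e = 0 := by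
    let E := LinearMap.range (LinearMap.mulLeft k e)
    have hE : ∀ x ∈ E, LinearMap.mulRight k a x ∈ E := by
      rintro _ ⟨y, rfl⟩
      exact ⟨y * a, by simp [mul_assoc]⟩
    have hsurj : Function.Surjective ((LinearMap.mulRight k a).restrict hE) := by
      rintro ⟨_, y, rfl⟩
      obtain ⟨z, hz⟩ := hsub y
      refine ⟨⟨e * z, z, rfl⟩, Subtype.ext ?_⟩
      change e * z * a = e * y
      rw [mul_assoc, ← hz, ← mul_assoc, hee]
    have hinj := IsNoetherian.injective_of_surjective_endomorphism _ hsurj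
    have := @hinj ⟨e, 1, by simp⟩ 0 (Subtype.ext (by simpa using hea))
    exact congrArg Subtype.val this
  have hinj : Function.Injective (LinearMap.toSpanSingleton B B a) := by
    rw [← LinearMap.ker_eq_bot, LinearMap.ker_eq_bot']
    intro x hx
    rw [← hN x hx, he0, mul_zero]
  obtain ⟨y, hy⟩ := IsArtinian.surjective_of_injective_endomorphism _ hinj 1
  have hy : y * a = 1 := hy
  exact ⟨⟨a, y, mul_eq_one_symm hy, hy⟩, rfl⟩

/-- In an artinian ring that is noetherian over a commutative ring, a left unimodular pair `(a, b)`
can be shortened to a unit `a + t * b`. -/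
theorem exists_isUnit_add_mul_of_isArtinianRing (k : Type*) {B : Type*} [CommRing k] [Ring B]
    [Algebra k B] [IsNoetherian k B] [IsArtinianRing B] {a b c d : B} (h : c * a + d * b = 1) :
    ∃ t, IsUnit (a + t * b) := by
  -- Shorten modulo the Jacobson radical; it is nilpotent, so units modulo it are units.
  let q := Ideal.Quotient.mk (Ring.jacobson B)
  have hq : Function.Surjective q := Ideal.Quotient.mk_surjective
  have : IsNoetherian k (B ⧸ Ring.jacobson B) :=
    isNoetherian_of_surjective (Ideal.Quotient.mkₐ k (Ring.jacobson B)).toLinearMap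
      (LinearMap.range_eq_top.2 hq)
  obtain ⟨t', -, ht⟩ := exists_isUnit_add_mul_of_isSemisimpleRing k (⊤ : AddSubmonoid _)
    (fun x => ⟨1, isUnit_one, trivial⟩) (show q c * q a + q d * q b = 1 by
      rw [← map_mul, ← map_mul, ← map_add, h, map_one])
  obtain ⟨t, rfl⟩ := hq t'
  refine ⟨t, ?_⟩
  rw [← map_mul, ← map_add] at ht
  generalize a + t * b = x at ht
  obtain ⟨n, hn⟩ := IsSemiprimaryRing.isNilpotent (R := B)
  have hnil : ∀ y : B, q y = 1 → IsUnit y := by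
    intro y hy
    have hy' : y - 1 ∈ Ring.jacobson B := by
      rw [← Ideal.Quotient.eq_zero_iff_mem, map_sub, map_one, sub_eq_zero]; exact hy
    have : IsNilpotent (y - 1) := ⟨n, by
      have := Ideal.pow_mem_pow hy' n
      rw [hn] at this; exact this⟩
    simpa using this.isUnit_add_one
  obtain ⟨⟨_, y', h1, h2⟩, rfl⟩ := ht
  obtain ⟨y, rfl⟩ := hq y'
  obtain ⟨z, hz⟩ := (hnil (y * x) (by rw [map_mul]; exact h2)).exists_left_inv
  rw [← mul_assoc] at hz
  exact ⟨⟨x, z * y, mul_eq_one_symm hz, hz⟩, rfl⟩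

/-- A finite torsion module with a nonzero annihilating scalar over a Dedekind domain is
artinian. -/
theorem isArtinian_of_smul_eq_zero {R M : Type*} [CommRing R] [IsDedekindDomain R]
    [AddCommGroup M] [Module R M] [Module.Finite R M] {r : R} (hr : r ≠ 0)
    (h : ∀ x : M, r • x = 0) : IsArtinian R M := by
  have hlen := isFiniteLength_quotient_span_singleton R (mem_nonZeroDivisors_of_ne_zero hr)
  have := (isFiniteLength_iff_isNoetherian_isArtinian.1 hlen).2
  obtain ⟨n, f, hf⟩ := Module.Finite.exists_fin' R M
  have hle : ∀ m : M, Ideal.span {r} ≤ LinearMap.ker (LinearMap.toSpanSingleton R M m) := by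
    intro m
    rw [Ideal.span_singleton_le_iff_mem, LinearMap.mem_ker]
    exact h m
  -- The module is a quotient of a finite power of R/(r), which has finite length.
  let F : (Fin n → R ⧸ Ideal.span {r}) →ₗ[R] M :=
    LinearMap.lsum R (fun _ : Fin n => R ⧸ Ideal.span {r}) R
      (fun i => (Ideal.span {r}).liftQ _ (hle (f fun j => if i = j then 1 else 0)))
  refine isArtinian_of_surjective _ F fun x => ?_
  obtain ⟨y, rfl⟩ := hf x
  refine ⟨fun i => Submodule.Quotient.mk (y i), ?_⟩
  rw [LinearMap.pi_apply_eq_sum_univ f y]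
  simp only [F, LinearMap.lsum_apply, LinearMap.sum_apply, LinearMap.comp_apply,
    LinearMap.proj_apply]
  rfl

/-- A torsion algebra that is finite over a Dedekind domain is an artinian ring. -/
theorem isArtinianRing_of_isTorsion {R C : Type*} [CommRing R] [IsDedekindDomain R] [Ring C]
    [Algebra R C] [Module.Finite R C] (h : Module.IsTorsion R C) : IsArtinianRing C := by
  obtain ⟨⟨r, hr⟩, h1⟩ := @h 1
  have h1 : r • (1 : C) = 0 := h1
  have : IsArtinian R C := isArtinian_of_smul_eq_zero (nonZeroDivisors.ne_zero hr)
    fun x => by rw [← one_mul x, ← smul_mul_assoc, h1, zero_mul]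
  exact isArtinian_of_tower R this

end StableRange

/-! ### Stable range of orders -/

section Orders

variable {R K A : Type*} [CommRing R] [IsDedekindDomain R] [Field K] [Algebra R K]
  [IsFractionRing R K] [Ring A] [Algebra K A] [Algebra R A] [IsScalarTower R K A]

/-- Denominators can be cleared in the ambient algebra of an order. -/
theorem ROrder.exists_smul_mem (Λ : ROrder R K A) (x : A) :
    ∃ r : R, r ≠ 0 ∧ r • x ∈ Λ.toSubalgebra := by
  have hx : x ∈ Submodule.span K (Λ.toSubalgebra : Set A) := by rw [Λ.span_eq_top']; trivial
  induction hx using Submodule.span_induction with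
  | mem x hx => exact ⟨1, one_ne_zero, by rwa [one_smul]⟩
  | zero => exact ⟨1, one_ne_zero, by rw [smul_zero]; exact zero_mem _⟩
  | add x y _ _ hx hy =>
    obtain ⟨r, hr, hx⟩ := hx
    obtain ⟨s, hs, hy⟩ := hy
    refine ⟨r * s, mul_ne_zero hr hs, ?_⟩
    rw [smul_add]
    refine add_mem ?_ ?_
    · rw [mul_comm, mul_smul]; exact Subalgebra.smul_mem _ hx _
    · rw [mul_smul]; exact Subalgebra.smul_mem _ hy _
  | smul k x _ hx =>
    obtain ⟨r, hr, hx⟩ := hx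
    obtain ⟨n, d, hd, rfl⟩ := IsFractionRing.div_surjective (A := R) k
    have hd0 : d ≠ 0 := nonZeroDivisors.ne_zero hd
    refine ⟨r * d, mul_ne_zero hr hd0, ?_⟩
    have hd' : algebraMap R K d ≠ 0 := by
      rwa [Ne, FaithfulSMul.algebraMap_eq_zero_iff]
    have : (r * d) • (algebraMap R K n / algebraMap R K d) • x = n • r • x := by
      rw [← algebraMap_smul K (r * d), ← algebraMap_smul K n, ← algebraMap_smul K r x, smul_smul,
        smul_smul, map_mul]
      congr 1
      field_simp
    rw [this]
    exact Subalgebra.smul_mem _ hx _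

/-- A left unimodular pair in an order can be shortened to an element that is invertible in the
ambient algebra. -/
theorem ROrder.exists_mul_add_mul_eq_algebraMap [FiniteDimensional K A] [IsSemisimpleRing A]
    (Λ : ROrder R K A) {a b c d : Λ} (h : c * a + d * b = 1) :
    ∃ (t y : Λ) (r : R), r ≠ 0 ∧ y * (a + t * b) = algebraMap R Λ r := by
  -- Clearing denominators lets the shortening coefficient over the algebra be taken in the order
  -- itself.
  obtain ⟨t, ht, hu⟩ := exists_isUnit_add_mul_of_isSemisimpleRing K
    (Subalgebra.toSubmodule Λ.toSubalgebra).toAddSubmonoid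
    (fun x => by
      obtain ⟨r, hr, hx⟩ := Λ.exists_smul_mem x
      refine ⟨algebraMap R K r, ?_, by rwa [algebraMap_smul]⟩
      rwa [isUnit_iff_ne_zero, Ne, FaithfulSMul.algebraMap_eq_zero_iff])
    (show (c : A) * a + d * b = 1 by exact_mod_cast congrArg Subtype.val h)
  obtain ⟨z, hz⟩ := hu.exists_left_inv
  obtain ⟨r, hr, hrz⟩ := Λ.exists_smul_mem z
  refine ⟨⟨t, ht⟩, ⟨r • z, hrz⟩, r, hr, Subtype.ext ?_⟩
  change (r • z) * (a + t * b) = algebraMap R A r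
  rw [smul_mul_assoc, hz, Algebra.algebraMap_eq_smul_one]

/-- A left unimodular pair in a finite algebra over a Dedekind domain can be shortened to an element
that is left invertible modulo a given nonzero scalar. -/
theorem exists_mul_add_mul_eq_one_add {Λ : Type*} [Ring Λ] [Algebra R Λ] [Module.Finite R Λ] {r : R}
    (hr : r ≠ 0) {a b c d : Λ} (h : c * a + d * b = 1) :
    ∃ t z w : Λ, z * (a + t * b) = 1 + w * algebraMap R Λ r := by
  let I : Ideal Λ := LinearMap.range (LinearMap.toSpanSingleton Λ Λ (algebraMap R Λ r))
  have : I.IsTwoSided := ⟨by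
    rintro _ y ⟨x, rfl⟩
    refine ⟨x * y, ?_⟩
    simp [mul_assoc, Algebra.commutes]⟩
  let q := Ideal.Quotient.mkₐ R I
  have hq : Function.Surjective q := Ideal.Quotient.mk_surjective
  have : Module.Finite R (Λ ⧸ I) := Module.Finite.of_surjective q.toLinearMap hq
  have : IsArtinian R (Λ ⧸ I) := isArtinian_of_smul_eq_zero hr fun x => by
    obtain ⟨x, rfl⟩ := hq x
    rw [← map_smul]
    refine Ideal.Quotient.eq_zero_iff_mem.2 ⟨x, ?_⟩
    simp [Algebra.smul_def, Algebra.commutes]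
  have : IsArtinianRing (Λ ⧸ I) := isArtinian_of_tower R this
  obtain ⟨t, ht⟩ := exists_isUnit_add_mul_of_isArtinianRing R
    (show q c * q a + q d * q b = 1 by rw [← map_mul, ← map_mul, ← map_add, h, map_one])
  obtain ⟨t, rfl⟩ := hq t
  obtain ⟨z, hz⟩ := ht.exists_left_inv
  obtain ⟨z, rfl⟩ := hq z
  rw [← map_mul, ← map_add, ← map_mul, ← map_one q] at hz
  obtain ⟨w, hw⟩ := Ideal.Quotient.eq.1 hz
  refine ⟨t, z, w, ?_⟩
  rw [← sub_eq_iff_eq_add']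
  exact hw.symm

/-- The stable range of an order over a Dedekind domain is at most two: left unimodular triples can
be shortened. -/
theorem ROrder.exists_shorten [FiniteDimensional K A] [IsSemisimpleRing A] (Λ : ROrder R K A)
    {x a b c d : Λ} (h : x + c * a + d * b = 1) :
    ∃ t s t' p q : Λ, p * (a + t * x + s * b) + q * (b + t' * x) = 1 := by
  -- Put a' = a + t(x + db), so that ya' = r.
  obtain ⟨t, y, r, hr, hy⟩ := Λ.exists_mul_add_mul_eq_algebraMap (a := a) (b := x + d * b) (c := c)
    (d := 1) (Eq.trans (by noncomm_ring) h)
  -- The relation also reads (d - ctd)b + ((1 - ct)x + ca') = 1. Shortening this pair modulo `r`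
  -- leaves the error wr = wya', a left multiple of a' that the coefficient of a' absorbs.
  obtain ⟨t', z, w, hz⟩ := exists_mul_add_mul_eq_one_add hr (a := b)
    (b := (1 - c * t) * x + c * (a + t * (x + d * b))) (c := d - c * t * d) (d := 1)
    (Eq.trans (by noncomm_ring) h)
  refine ⟨t, t * d, t' * (1 - c * t), z * t' * c - w * y, z, ?_⟩
  rw [← hy, ← sub_eq_iff_eq_add] at hz
  exact Eq.trans (by noncomm_ring) hz

end Orders

/-! ### Split functionals and cancellation of one free summand -/

section UnimodularRows

variable {Λ : Type*} [Ring Λ]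

/-- If left unimodular triples over `Λ` can be shortened, then the linear automorphisms of a module
with three dual pairs of vectors and functionals move every split functional to a given one. -/
theorem exists_linearEquiv_functional_eq
    (hΛ : ∀ x a b c d : Λ, x + c * a + d * b = 1 →
      ∃ t s t' p q : Λ, p * (a + t * x + s * b) + q * (b + t' * x) = 1)
    {M : Type*} [AddCommGroup M] [Module Λ M] {ε P Q : M →ₗ[Λ] Λ} {e₀ p₀ q₀ : M}
    (hεe : ε e₀ = 1) (hεp : ε p₀ = 0) (hεq : ε q₀ = 0)
    (hPe : P e₀ = 0) (hPp : P p₀ = 1) (hPq : P q₀ = 0)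
    (hQe : Q e₀ = 0) (hQp : Q p₀ = 0) (hQq : Q q₀ = 1)
    (f : M →ₗ[Λ] Λ) (m₀ : M) (hf : f m₀ = 1) :
    ∃ φ : M ≃ₗ[Λ] M, ∀ m, f (φ m) = ε m := by
  -- The part of `m₀` killed by `P` and `Q`: now `f y`, `f p₀`, `f q₀` form a unimodular triple, and
  -- transvections along `y` and `q₀` realise its shortening.
  set y := m₀ - P m₀ • p₀ - Q m₀ • q₀ with hy
  have hPy : P y = 0 := by simp [hy, hPp, hPq]
  have hQy : Q y = 0 := by simp [hy, hQp, hQq]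
  obtain ⟨t, s, t', p, q, h⟩ := hΛ (f y) (f p₀) (f q₀) (P m₀) (Q m₀) (by
    simp only [hy, map_sub, map_smul, smul_eq_mul, hf]; abel)
  let T₁ : M ≃ₗ[Λ] M := LinearEquiv.transvection (f := P) (v := t • y + s • q₀) (by simp [hPy, hPq])
  let T₂ : M ≃ₗ[Λ] M := LinearEquiv.transvection (f := Q) (v := t' • y) (by simp [hQy])
  let f₂ : M →ₗ[Λ] Λ := f ∘ₗ (T₁ : M →ₗ[Λ] M) ∘ₗ (T₂ : M →ₗ[Λ] M)
  have hf₂ : ∀ m, f₂ m = f (T₁ (T₂ m)) := fun _ => rfl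
  have hf₂p : f₂ p₀ = f p₀ + t * f y + s * f q₀ := by
    simp only [hf₂, T₁, T₂, LinearEquiv.transvection.apply]
    simp [hPp, hQp, add_assoc]
  have hf₂q : f₂ q₀ = f q₀ + t' * f y := by
    simp only [hf₂, T₁, T₂, LinearEquiv.transvection.apply]
    simp [hPq, hQq, hPy]
  -- The functional `f₂` is 1 at v = p • p₀ + q • q₀. The terms in `P` and `Q` make `ℓ` vanish at v,
  -- so the transvection `T₃` turns `f₂` into f₂ + ℓ. Then `T₄`, along `e₀`, removes those terms.
  let ℓ : M →ₗ[Λ] Λ := ε - f₂ + P.smulRight (f₂ p₀) + Q.smulRight (f₂ q₀)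
  have hℓ : ∀ m, ℓ m = ε m - f₂ m + P m * f₂ p₀ + Q m * f₂ q₀ := fun _ => rfl
  let ℓ' : M →ₗ[Λ] Λ := -(P.smulRight (f₂ p₀) + Q.smulRight (f₂ q₀))
  have hℓ' : ∀ m, ℓ' m = -(P m * f₂ p₀ + Q m * f₂ q₀) := fun _ => rfl
  let T₃ : M ≃ₗ[Λ] M := LinearEquiv.transvection (f := ℓ) (v := p • p₀ + q • q₀)
    (by simp [hℓ, hεp, hεq, hPp, hPq, hQp, hQq])
  let T₄ : M ≃ₗ[Λ] M := LinearEquiv.transvection (f := ℓ') (v := e₀) (by simp [hℓ', hPe, hQe])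
  have hv : f₂ (p • p₀ + q • q₀) = 1 := by
    rw [map_add, map_smul, map_smul, hf₂p, hf₂q]; exact h
  have hT₃ : ∀ m, f₂ (T₃ m) = ε m + P m * f₂ p₀ + Q m * f₂ q₀ := by
    intro m
    rw [LinearEquiv.transvection.apply, map_add, map_smul, hv, hℓ, smul_eq_mul, mul_one]
    abel
  refine ⟨T₄.trans (T₃.trans (T₂.trans T₁)), fun m => ?_⟩
  change f₂ (T₃ (T₄ m)) = ε m
  rw [hT₃, LinearEquiv.transvection.apply]
  simp [hεe, hPe, hQe, hℓ']
  abel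

/-- A linear equivalence that preserves the first component induces one of the second factors. -/
theorem nonempty_linearEquiv_of_fst_eq {N X X' : Type*} [AddCommGroup N] [AddCommGroup X]
    [AddCommGroup X'] [Module Λ N] [Module Λ X] [Module Λ X'] (ψ : (N × X) ≃ₗ[Λ] (N × X'))
    (hψ : ∀ v, (ψ v).1 = v.1) : Nonempty (X ≃ₗ[Λ] X') := by
  have hψ' : ∀ v, (ψ.symm v).1 = v.1 := fun v => by rw [← hψ, ψ.apply_symm_apply]
  refine ⟨LinearEquiv.ofLinearMap
    (LinearMap.snd Λ N X' ∘ₗ (ψ : (N × X) →ₗ[Λ] (N × X')) ∘ₗ LinearMap.inr Λ N X)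
    (LinearMap.snd Λ N X ∘ₗ (ψ.symm : (N × X') →ₗ[Λ] (N × X)) ∘ₗ LinearMap.inr Λ N X') ?_ ?_⟩
  · ext x
    have : ((0 : N), (ψ.symm (0, x)).2) = ψ.symm (0, x) :=
      Prod.ext (hψ' (0, x)).symm rfl
    simp [this]
  · ext x
    have : ((0 : N), (ψ (0, x)).2) = ψ (0, x) :=
      Prod.ext (hψ (0, x)).symm rfl
    simp [this]

/-- If the automorphisms of `Λ^(n+1)` act transitively on split functionals, then `Λ` can be
cancelled from `Λ × X ≅ Λ^(n+1)`. -/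
theorem nonempty_linearEquiv_of_prod {n : ℕ}
    (h : ∀ (f : (Fin (n + 1) → Λ) →ₗ[Λ] Λ) (m₀ : Fin (n + 1) → Λ), f m₀ = 1 →
      ∃ φ : (Fin (n + 1) → Λ) ≃ₗ[Λ] (Fin (n + 1) → Λ), ∀ m, f (φ m) = m 0)
    {X : Type*} [AddCommGroup X] [Module Λ X] (e : (Λ × X) ≃ₗ[Λ] (Fin (n + 1) → Λ)) :
    Nonempty (X ≃ₗ[Λ] (Fin n → Λ)) := by
  -- Since `φ` carries the projection onto Λ, read through `e`, to the zeroth coordinate, `e`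
  -- followed by the inverse of `φ` preserves the Λ-component.
  obtain ⟨φ, hφ⟩ := h (LinearMap.fst Λ Λ X ∘ₗ (e.symm : (Fin (n + 1) → Λ) →ₗ[Λ] (Λ × X)))
    (e (1, 0)) (by simp)
  refine nonempty_linearEquiv_of_fst_eq
    (e.trans (φ.symm.trans (Fin.consLinearEquiv Λ (fun _ : Fin (n + 1) => Λ)).symm)) fun v => ?_
  change φ.symm (e v) 0 = v.1
  rw [← hφ (φ.symm (e v))]
  simp

/-- `GL₂(Λ)` acts transitively on left unimodular columns of length two. -/
def TransitiveOnUnimodularPairs (Λ : Type*) [Ring Λ] : Prop :=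
  ∀ v w : Fin 2 → Λ, w ⬝ᵥ v = 1 →
    ∃ P : (Matrix (Fin 2) (Fin 2) Λ)ˣ, (P : Matrix (Fin 2) (Fin 2) Λ).mulVec v = ![1, 0]

/-- A functional on row vectors is the pairing with a column `v`; precomposing with right
multiplication by `P` replaces `v` by Pv. -/
theorem TransitiveOnUnimodularPairs.exists_linearEquiv (h : TransitiveOnUnimodularPairs Λ)
    (f : (Fin 2 → Λ) →ₗ[Λ] Λ) (m₀ : Fin 2 → Λ) (hf : f m₀ = 1) :
    ∃ φ : (Fin 2 → Λ) ≃ₗ[Λ] (Fin 2 → Λ), ∀ m, f (φ m) = m 0 := by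
  let v : Fin 2 → Λ := fun i => f fun j => if i = j then 1 else 0
  have hv : ∀ m, f m = m ⬝ᵥ v := fun m => LinearMap.pi_apply_eq_sum_univ f m
  obtain ⟨P, hP⟩ := h v m₀ (by rw [← hv, hf])
  refine ⟨Matrix.toLinearEquivRight'OfInv P.inv_mul P.mul_inv, fun m => ?_⟩
  change f (Matrix.vecMul m P.1) = m 0
  rw [hv, ← Matrix.dotProduct_mulVec, hP]
  simp [dotProduct, Fin.sum_univ_two]

end UnimodularRows

/-! ### Stably free cancellation in terms of unimodular pairs -/

section Cancellation

variable {Λ : Type u} [Ring Λ] [IsNoetherianRing Λ]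

/-- Stably free cancellation lets one complete unimodular columns of length two. -/
theorem HasSFC.transitiveOnUnimodularPairs (h : HasSFC Λ) : TransitiveOnUnimodularPairs Λ := by
  intro v w hwv
  let f : (Fin 2 → Λ) →ₗ[Λ] Λ :=
    { toFun := fun m => m ⬝ᵥ v
      map_add' := fun m n => add_dotProduct m n v
      map_smul' := fun a m => smul_dotProduct a m v }
  have hf : ∀ m, f m = m ⬝ᵥ v := fun _ => rfl
  have hker : ∀ m, m - f m • w ∈ LinearMap.ker f := fun m => by
    rw [LinearMap.mem_ker, map_sub, map_smul, hf w, hwv, smul_eq_mul, mul_one, sub_self]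
  -- The kernel of `f` is a complement of the free summand Λw in Λ², so cancellation makes it free
  -- of rank one.
  let e : (LinearMap.ker f × (Fin 1 → Λ)) ≃ₗ[Λ] (Fin (1 + 1) → Λ) :=
    { toFun := fun x => x.1.1 + x.2 0 • w
      map_add' := fun x y => by simp [add_smul]; abel
      map_smul' := fun a x => by simp [mul_smul]
      invFun := fun m => (⟨m - f m • w, hker m⟩, fun _ => f m)
      left_inv := fun x => by
        have hx : f x.1.1 = 0 := x.1.2
        have hx' : f (x.1.1 + x.2 0 • w) = x.2 0 := by
          rw [map_add, map_smul, hx, hf w, hwv]; simp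
        refine Prod.ext (Subtype.ext ?_) (funext fun i => ?_)
        · change x.1.1 + x.2 0 • w - f (x.1.1 + x.2 0 • w) • w = x.1.1
          rw [hx', add_sub_cancel_right]
        · change f (x.1.1 + x.2 0 • w) = x.2 i
          rw [hx', Subsingleton.elim 0 i]
      right_inv := fun m => by simp }
  obtain ⟨ψ⟩ := h (LinearMap.ker f) 1 1 ⟨e⟩
  let x₀ := ψ.symm fun _ => 1
  have hψ : ∀ k : LinearMap.ker f, ψ k 0 • x₀ = k := fun k => by
    rw [← map_smul, LinearEquiv.symm_apply_eq]
    ext i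
    rw [Subsingleton.elim i 0]
    simp
  -- The rows `w` and `x₀`, a basis of the kernel, form a basis of Λ². The rows of `P` are the
  -- coordinates of the standard vectors in it, and Qv = (1, 0) by construction.
  let Q : Matrix (Fin 2) (Fin 2) Λ := Matrix.of ![w, x₀.1]
  let P : Matrix (Fin 2) (Fin 2) Λ :=
    Matrix.of fun i => ![v i, ψ ⟨Pi.single i 1 - f (Pi.single i 1) • w, hker _⟩ 0]
  have hPQ : P * Q = 1 := by
    ext i j
    have h1 := congrFun (congrArg Subtype.val (hψ ⟨Pi.single i 1 - f (Pi.single i 1) • w, hker _⟩)) j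
    have h2 : f (Pi.single i 1) = v i := by simp [hf]
    simp only [SetLike.val_smul, Pi.smul_apply, Pi.sub_apply, smul_eq_mul] at h1
    rw [Matrix.mul_apply, Fin.sum_univ_two]
    simp only [P, Q, Matrix.of_apply, Matrix.cons_val_zero, Matrix.cons_val_one]
    rw [h1, h2, Matrix.one_apply, Pi.single_apply]
    simp [eq_comm]
  refine ⟨⟨Q, P, mul_eq_one_symm hPQ, hPQ⟩, ?_⟩
  ext i
  fin_cases i
  · exact hwv
  · exact x₀.2

/-- A noetherian ring over which unimodular triples can be shortened and unimodular pairs can be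
completed has stably free cancellation. -/
theorem TransitiveOnUnimodularPairs.hasSFC (h : TransitiveOnUnimodularPairs Λ)
    (hΛ : ∀ x a b c d : Λ, x + c * a + d * b = 1 →
      ∃ t s t' p q : Λ, p * (a + t * x + s * b) + q * (b + t' * x) = 1) : HasSFC Λ := by
  have key : ∀ (n : ℕ), 1 ≤ n → ∀ (X : Type u) [AddCommGroup X] [Module Λ X],
      Nonempty ((Λ × X) ≃ₗ[Λ] (Fin (n + 1) → Λ)) → Nonempty (X ≃ₗ[Λ] (Fin n → Λ)) := by
    rintro n hn X _ _ ⟨e⟩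
    refine nonempty_linearEquiv_of_prod (fun f m₀ hf => ?_) e
    -- Only n = 1 needs the hypothesis on pairs; for n ≥ 2 there are three coordinates, enough for
    -- the stable range argument.
    obtain rfl | ⟨n, rfl⟩ : n = 1 ∨ ∃ k, n = k + 2 := by
      rcases n with _ | _ | n
      · omega
      · exact Or.inl rfl
      · exact Or.inr ⟨n, rfl⟩
    · exact h.exists_linearEquiv f m₀ hf
    · have h01 : (0 : Fin (n + 2 + 1)) ≠ 1 := by simp
      have h2 : 2 % (n + 2 + 1) = 2 := Nat.mod_eq_of_lt (by omega)
      have h02 : (0 : Fin (n + 2 + 1)) ≠ 2 := by simp [Fin.ext_iff, h2]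
      have h12 : (1 : Fin (n + 2 + 1)) ≠ 2 := by simp [Fin.ext_iff, h2]
      exact exists_linearEquiv_functional_eq hΛ (ε := LinearMap.proj 0) (P := LinearMap.proj 1)
        (Q := LinearMap.proj 2) (e₀ := Pi.single 0 1) (p₀ := Pi.single 1 1) (q₀ := Pi.single 2 1)
        (by simp) (by simp [h01]) (by simp [h02]) (by simp [h01.symm]) (by simp) (by simp [h12])
        (by simp [h02.symm]) (by simp [h12.symm]) (by simp) f m₀ hf
  have main : ∀ (m n : ℕ), 1 ≤ n → ∀ (X : Type u) [AddCommGroup X] [Module Λ X],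
      Nonempty ((X × (Fin m → Λ)) ≃ₗ[Λ] (Fin (m + n) → Λ)) → Nonempty (X ≃ₗ[Λ] (Fin n → Λ)) := by
    intro m
    induction m with
    | zero =>
      rintro n - X _ _ ⟨e⟩
      rw [Nat.zero_add] at e
      exact ⟨(LinearEquiv.prodUnique (R := Λ)).symm.trans e⟩
    | succ m ih =>
      rintro n hn X _ _ ⟨e⟩
      rw [add_assoc, add_comm 1 n] at e
      refine key n hn X (ih (n + 1) (by omega) (Λ × X) ⟨?_⟩)
      exact ((LinearEquiv.prodComm Λ Λ X).prodCongr (LinearEquiv.refl Λ _)).trans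
        ((LinearEquiv.prodAssoc Λ X Λ (Fin m → Λ)).trans
          (((LinearEquiv.refl Λ X).prodCongr
            (Fin.consLinearEquiv Λ (fun _ : Fin (m + 1) => Λ))).trans e))
  intro X _ _ _ m n ⟨e⟩
  rcases Nat.eq_zero_or_pos n with rfl | hn
  -- For n = 0, projecting X ⊕ Λᵐ ≅ Λᵐ to Λᵐ gives a surjective endomorphism of a noetherian module.
  -- It is injective, so X = 0.
  · have hinj : Function.Injective
        ((LinearMap.snd Λ X (Fin m → Λ)) ∘ₗ (e.symm : (Fin m → Λ) →ₗ[Λ] _)) :=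
      IsNoetherian.injective_of_surjective_endomorphism _
        (Prod.snd_surjective.comp e.symm.surjective)
    have : Subsingleton X := ⟨fun x y => by
      have := @hinj (e (x, 0)) (e (y, 0)) (by simp)
      simpa using this⟩
    exact ⟨0, 0, fun _ => Subsingleton.elim _ _, fun _ => Subsingleton.elim _ _⟩
  · exact main m n hn X ⟨e⟩

end Cancellation

/-! ### Elementary matrices and their lifts -/

section ElementaryMatrices

variable {R Γ B : Type*} [CommRing R] [Ring Γ] [Ring B] [Algebra R Γ] [Algebra R B]

/-- The elementary matrix with `t` above the diagonal. -/
def upperElementary (t : Γ) : (Matrix (Fin 2) (Fin 2) Γ)ˣ where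
  val := !![1, t; 0, 1]
  inv := !![1, -t; 0, 1]
  val_inv := by ext i j; fin_cases i <;> fin_cases j <;> simp [Matrix.mul_apply]
  inv_val := by ext i j; fin_cases i <;> fin_cases j <;> simp [Matrix.mul_apply]

/-- The elementary matrix with `t` below the diagonal. -/
def lowerElementary (t : Γ) : (Matrix (Fin 2) (Fin 2) Γ)ˣ where
  val := !![1, 0; t, 1]
  inv := !![1, 0; -t, 1]
  val_inv := by ext i j; fin_cases i <;> fin_cases j <;> simp [Matrix.mul_apply]
  inv_val := by ext i j; fin_cases i <;> fin_cases j <;> simp [Matrix.mul_apply]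

/-- The diagonal matrix with entries `1` and `a`. -/
def oneDiag (a : Γˣ) : (Matrix (Fin 2) (Fin 2) Γ)ˣ where
  val := !![1, 0; 0, (a : Γ)]
  inv := !![1, 0; 0, ((a⁻¹ : Γˣ) : Γ)]
  val_inv := by ext i j; fin_cases i <;> fin_cases j <;> simp [Matrix.mul_apply]
  inv_val := by ext i j; fin_cases i <;> fin_cases j <;> simp [Matrix.mul_apply]

/-- The map on invertible matrices induced by an algebra homomorphism. -/
def AlgHom.mapMatrixUnits (g : Γ →ₐ[R] B) :
    (Matrix (Fin 2) (Fin 2) Γ)ˣ →* (Matrix (Fin 2) (Fin 2) B)ˣ :=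
  Units.map ((g.mapMatrix : Matrix (Fin 2) (Fin 2) Γ →ₐ[R] Matrix (Fin 2) (Fin 2) B) :
    Matrix (Fin 2) (Fin 2) Γ →* Matrix (Fin 2) (Fin 2) B)

theorem AlgHom.mapMatrix_mulVec (g : Γ →ₐ[R] B) (P : Matrix (Fin 2) (Fin 2) Γ) (v : Fin 2 → Γ) :
    (g.mapMatrix P).mulVec (g ∘ v) = g ∘ P.mulVec v :=
  funext fun i => (RingHom.map_mulVec (g : Γ →+* B) P v i).symm

theorem AlgHom.vecMul_mapMatrix (g : Γ →ₐ[R] B) (P : Matrix (Fin 2) (Fin 2) Γ) (v : Fin 2 → Γ) :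
    Matrix.vecMul (g ∘ v) (g.mapMatrix P) = g ∘ Matrix.vecMul v P :=
  funext fun i => (RingHom.map_vecMul (g : Γ →+* B) P v i).symm

theorem AlgHom.comp_vecCons (g : Γ →ₐ[R] B) (a b : Γ) : g ∘ ![a, b] = ![g a, g b] := by
  ext i; fin_cases i <;> rfl

theorem AlgHom.comp_dotProduct (g : Γ →ₐ[R] B) (v w : Fin 2 → Γ) :
    (g ∘ w) ⬝ᵥ (g ∘ v) = g (w ⬝ᵥ v) := by
  simp [dotProduct]

/-- Over a ring in which unimodular pairs can be shortened, unimodular columns of length two are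
moved to the first basis vector by elementary matrices, which lift along surjections. -/
theorem exists_mapMatrix_mulVec_eq (hB : ∀ a b c d : B, c * a + d * b = 1 → ∃ t, IsUnit (a + t * b))
    (g : Γ →ₐ[R] B) (hg : Function.Surjective g) (v w : Fin 2 → B) (h : w ⬝ᵥ v = 1) :
    ∃ E : (Matrix (Fin 2) (Fin 2) Γ)ˣ,
      (g.mapMatrix (E : Matrix (Fin 2) (Fin 2) Γ)).mulVec v = ![1, 0] := by
  have hU : ∀ (t : Γ) (a b : B),
      (g.mapMatrix (upperElementary t : Matrix (Fin 2) (Fin 2) Γ)).mulVec ![a, b] =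
        ![a + g t * b, b] := by
    intro t a b
    ext i; fin_cases i <;> simp [upperElementary, Matrix.mulVec, dotProduct]
  have hL : ∀ (t : Γ) (a b : B),
      (g.mapMatrix (lowerElementary t : Matrix (Fin 2) (Fin 2) Γ)).mulVec ![a, b] =
        ![a, g t * a + b] := by
    intro t a b
    ext i; fin_cases i <;> simp [lowerElementary, Matrix.mulVec, dotProduct]
  obtain ⟨a, b, rfl⟩ : ∃ a b, v = ![a, b] := ⟨v 0, v 1, by ext i; fin_cases i <;> rfl⟩
  obtain ⟨t, u, hu⟩ := hB a b (w 0) (w 1) (by simpa [dotProduct, Fin.sum_univ_two] using h)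
  obtain ⟨t, rfl⟩ := hg t
  obtain ⟨s, hs⟩ := hg ((1 - b) * ((u⁻¹ : Bˣ) : B))
  obtain ⟨r, hr⟩ := hg (1 - u)
  -- Read from the right: (a, b) ↦ (u, b) ↦ (u, 1) ↦ (1, 1) ↦ (1, 0).
  refine ⟨lowerElementary (-1) * upperElementary r * lowerElementary s * upperElementary t, ?_⟩
  simp only [Units.val_mul, map_mul, ← Matrix.mulVec_mulVec, hU, hL, ← hu, hs, hr]
  simp

end ElementaryMatrices

/-! ### Milnor patching over the fibre product -/

namespace FibreProduct

variable {R : Type*} [CommRing R] {Λ Λ₁ Λ₂ Λbar : Type*} [Ring Λ] [Ring Λ₁] [Ring Λ₂]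
    [Ring Λbar] [Algebra R Λ] [Algebra R Λ₁] [Algebra R Λ₂] [Algebra R Λbar]
    (D : FibreProduct R Λ Λ₁ Λ₂ Λbar)

/-- The fibre product with the two factors interchanged. -/
def swap : FibreProduct R Λ Λ₂ Λ₁ Λbar where
  π₁ := D.π₂
  π₂ := D.π₁
  g₁ := D.g₂
  g₂ := D.g₁
  comm x := (D.comm x).symm
  existsUnique x₁ x₂ h := by simpa only [and_comm] using D.existsUnique x₂ x₁ h.symm

theorem inv_mem_W_swap {u : Λbarˣ} (hu : u ∈ D.W) : u⁻¹ ∈ D.swap.W := by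
  obtain ⟨a, b, rfl⟩ := hu
  exact ⟨b⁻¹, a⁻¹, by rw [mul_inv_rev, map_inv, map_inv]; rfl⟩

/-- Interchanging the factors turns `M(u)` into `M(u⁻¹)`. -/
def swapEquiv (u : Λbarˣ) : D.M u ≃ₗ[Λ] D.swap.M u⁻¹ where
  toFun x := ⟨(x.1.2, x.1.1), by
    change D.g₂ x.1.2 * ((u⁻¹ : Λbarˣ) : Λbar) = D.g₁ x.1.1
    rw [← D.M_mem u x, Units.mul_inv_cancel_right]⟩
  map_add' _ _ := rfl
  map_smul' _ _ := rfl
  invFun x := ⟨(x.1.2, x.1.1), by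
    change D.g₁ x.1.2 * u = D.g₂ x.1.1
    have : D.g₂ x.1.1 * ((u⁻¹ : Λbarˣ) : Λbar) = D.g₁ x.1.2 := x.2
    rw [← this, Units.inv_mul_cancel_right]⟩
  left_inv _ := rfl
  right_inv _ := rfl

/-- The fibre product of matrix rings. -/
noncomputable def matrix : FibreProduct R (Matrix (Fin 2) (Fin 2) Λ) (Matrix (Fin 2) (Fin 2) Λ₁)
    (Matrix (Fin 2) (Fin 2) Λ₂) (Matrix (Fin 2) (Fin 2) Λbar) where
  π₁ := D.π₁.mapMatrix
  π₂ := D.π₂.mapMatrix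
  g₁ := D.g₁.mapMatrix
  g₂ := D.g₂.mapMatrix
  comm X := by ext i j; exact D.comm _
  existsUnique X₁ X₂ h := by
    have h' : ∀ i j, D.g₁ (X₁ i j) = D.g₂ (X₂ i j) := fun i j => congrFun (congrFun h i) j
    refine ⟨Matrix.of fun i j => D.lift _ _ (h' i j), ⟨?_, ?_⟩, ?_⟩
    · ext i j; exact D.π₁_lift _ _ (h' i j)
    · ext i j; exact D.π₂_lift _ _ (h' i j)
    · rintro Y ⟨rfl, rfl⟩
      ext i j
      exact D.hom_ext (D.π₁_lift _ _ (h' i j)).symm (D.π₂_lift _ _ (h' i j)).symm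

/-- The inverses also agree over Λbar, so they glue. Applied to `D.matrix`, this glues elements of
GL₂. -/
theorem exists_units_lift (a₁ : Λ₁ˣ) (a₂ : Λ₂ˣ) (h : D.g₁ a₁ = D.g₂ a₂) :
    ∃ a : Λˣ, D.π₁ a = a₁ ∧ D.π₂ a = a₂ := by
  have h' : D.g₁ ((a₁⁻¹ : Λ₁ˣ) : Λ₁) = D.g₂ ((a₂⁻¹ : Λ₂ˣ) : Λ₂) := by
    have h1 : Units.map (D.g₁ : Λ₁ →* Λbar) a₁ = Units.map (D.g₂ : Λ₂ →* Λbar) a₂ := Units.ext h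
    have h2 := congrArg Units.val (congrArg Inv.inv h1)
    rwa [← map_inv, ← map_inv] at h2
  exact ⟨⟨D.lift _ _ h, D.lift _ _ h',
    D.hom_ext (by simp [π₁_lift]) (by simp [π₂_lift]),
    D.hom_ext (by simp [π₁_lift]) (by simp [π₂_lift])⟩, D.π₁_lift _ _ h, D.π₂_lift _ _ h⟩

theorem exists_vec_lift (v₁ : Fin 2 → Λ₁) (v₂ : Fin 2 → Λ₂) (h : D.g₁ ∘ v₁ = D.g₂ ∘ v₂) :
    ∃ v : Fin 2 → Λ, D.π₁ ∘ v = v₁ ∧ D.π₂ ∘ v = v₂ :=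
  ⟨fun i => D.lift _ _ (congrFun h i), funext fun _ => D.π₁_lift _ _ _,
    funext fun _ => D.π₂_lift _ _ _⟩

theorem comm_comp (v : Fin 2 → Λ) : D.g₁ ∘ D.π₁ ∘ v = D.g₂ ∘ D.π₂ ∘ v :=
  funext fun i => D.comm (v i)

/-- A factorisation of `diag(1, u)` through `GL₂(Λ₁)` and `GL₂(Λ₂)` makes `M(u)` stably free. -/
theorem stablyIsomorphic_M {u : Λbarˣ} (P₁ : (Matrix (Fin 2) (Fin 2) Λ₁)ˣ)
    (P₂ : (Matrix (Fin 2) (Fin 2) Λ₂)ˣ)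
    (h : D.g₁.mapMatrix P₁.1 = (oneDiag u).1 * D.g₂.mapMatrix P₂.1) :
    StablyIsomorphic Λ (D.M u) Λ := by
  have hS : D.g₁.mapMatrix P₁⁻¹.1 * (oneDiag u).1 = D.g₂.mapMatrix P₂⁻¹.1 := by
    have e1 : D.g₁.mapMatrix P₁⁻¹.1 * D.g₁.mapMatrix P₁.1 = 1 := by
      rw [← map_mul, P₁.inv_mul, map_one]
    have e2 : D.g₂.mapMatrix P₂.1 * D.g₂.mapMatrix P₂⁻¹.1 = 1 := by
      rw [← map_mul, P₂.mul_inv, map_one]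
    rw [← mul_one (oneDiag u).1, ← e2, ← mul_assoc (oneDiag u).1, ← h, ← mul_assoc, e1, one_mul]
  have hdiag : ∀ z : Fin 2 → Λbar, Matrix.vecMul z (oneDiag u).1 = ![z 0, z 1 * u] := fun z => by
    ext i; fin_cases i <;> simp [oneDiag, Matrix.vecMul, dotProduct]
  have hz : ∀ m : Fin 2 → Λ,
      ![D.g₁ (Matrix.vecMul (D.π₁ ∘ m) P₁⁻¹.1 0), D.g₁ (Matrix.vecMul (D.π₁ ∘ m) P₁⁻¹.1 1) * u] =
        D.g₂ ∘ Matrix.vecMul (D.π₂ ∘ m) P₂⁻¹.1 := fun m => by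
    rw [← AlgHom.vecMul_mapMatrix, ← hS, ← Matrix.vecMul_vecMul, ← comm_comp,
      AlgHom.vecMul_mapMatrix, hdiag]
    rfl
  have hz₀ : ∀ m : Fin 2 → Λ, D.g₁ (Matrix.vecMul (D.π₁ ∘ m) P₁⁻¹.1 0) =
      D.g₂ (Matrix.vecMul (D.π₂ ∘ m) P₂⁻¹.1 0) := fun m => congrFun (hz m) 0
  -- Changing coordinates by the inverses of `P₁` and `P₂` identifies Λ² with the pairs of rows (x,
  -- y) such that g₁(x) diag(1, u) = g₂(y). Coordinate 0 contributes Λ and coordinate 1 contributes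
  -- M(u).
  let F : (Fin 2 → Λ) →ₗ[Λ] (D.M u × (Fin 1 → Λ)) :=
    { toFun := fun m => (⟨(Matrix.vecMul (D.π₁ ∘ m) P₁⁻¹.1 1, Matrix.vecMul (D.π₂ ∘ m) P₂⁻¹.1 1),
        congrFun (hz m) 1⟩, fun _ => D.lift (Matrix.vecMul (D.π₁ ∘ m) P₁⁻¹.1 0)
          (Matrix.vecMul (D.π₂ ∘ m) P₂⁻¹.1 0) (hz₀ m))
      map_add' := fun m n => by
        have e₁ : D.π₁ ∘ (m + n) = D.π₁ ∘ m + D.π₁ ∘ n := funext fun _ => map_add _ _ _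
        have e₂ : D.π₂ ∘ (m + n) = D.π₂ ∘ m + D.π₂ ∘ n := funext fun _ => map_add _ _ _
        refine Prod.ext (Subtype.ext (Prod.ext ?_ ?_)) (funext fun _ => D.hom_ext ?_ ?_)
        · change Matrix.vecMul (D.π₁ ∘ (m + n)) _ 1 = _
          rw [e₁, Matrix.add_vecMul]; rfl
        · change Matrix.vecMul (D.π₂ ∘ (m + n)) _ 1 = _
          rw [e₂, Matrix.add_vecMul]; rfl
        · simp only [Prod.snd_add, Pi.add_apply, map_add, π₁_lift, e₁, Matrix.add_vecMul]
        · simp only [Prod.snd_add, Pi.add_apply, map_add, π₂_lift, e₂, Matrix.add_vecMul]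
      map_smul' := fun a m => by
        have e₁ : D.π₁ ∘ (a • m) = D.π₁ a • D.π₁ ∘ m := funext fun _ => map_mul _ _ _
        have e₂ : D.π₂ ∘ (a • m) = D.π₂ a • D.π₂ ∘ m := funext fun _ => map_mul _ _ _
        refine Prod.ext (Subtype.ext (Prod.ext ?_ ?_)) (funext fun _ => D.hom_ext ?_ ?_)
        · change Matrix.vecMul (D.π₁ ∘ (a • m)) _ 1 = _
          rw [e₁, Matrix.smul_vecMul]; rfl
        · change Matrix.vecMul (D.π₂ ∘ (a • m)) _ 1 = _
          rw [e₂, Matrix.smul_vecMul]; rfl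
        · simp only [Prod.smul_snd, Pi.smul_apply, smul_eq_mul, map_mul, π₁_lift, e₁,
            Matrix.smul_vecMul, RingHom.id_apply]
        · simp only [Prod.smul_snd, Pi.smul_apply, smul_eq_mul, map_mul, π₂_lift, e₂,
            Matrix.smul_vecMul, RingHom.id_apply] }
  have hF₁ : ∀ m, (F m).1.1 =
      (Matrix.vecMul (D.π₁ ∘ m) P₁⁻¹.1 1, Matrix.vecMul (D.π₂ ∘ m) P₂⁻¹.1 1) := fun _ => rfl
  have hF₂ : ∀ m, D.π₁ ((F m).2 0) = Matrix.vecMul (D.π₁ ∘ m) P₁⁻¹.1 0 := fun m => D.π₁_lift _ _ (hz₀ m)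
  have hF₃ : ∀ m, D.π₂ ((F m).2 0) = Matrix.vecMul (D.π₂ ∘ m) P₂⁻¹.1 0 := fun m => D.π₂_lift _ _ (hz₀ m)
  have hinj : Function.Injective F := by
    intro m n hmn
    have hfst := congrArg (fun x => x.1.1) hmn
    have hsnd := congrArg (fun x => x.2 0) hmn
    simp only [hF₁] at hfst
    have k₁ : Matrix.vecMul (D.π₁ ∘ m) P₁⁻¹.1 = Matrix.vecMul (D.π₁ ∘ n) P₁⁻¹.1 := by
      ext i; fin_cases i
      · exact (hF₂ m).symm.trans ((congrArg D.π₁ hsnd).trans (hF₂ n))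
      · exact congrArg Prod.fst hfst
    have k₂ : Matrix.vecMul (D.π₂ ∘ m) P₂⁻¹.1 = Matrix.vecMul (D.π₂ ∘ n) P₂⁻¹.1 := by
      ext i; fin_cases i
      · exact (hF₃ m).symm.trans ((congrArg D.π₂ hsnd).trans (hF₃ n))
      · exact congrArg Prod.snd hfst
    have l₁ := congrArg (fun z => Matrix.vecMul z P₁.1) k₁
    have l₂ := congrArg (fun z => Matrix.vecMul z P₂.1) k₂
    simp only [Matrix.vecMul_vecMul, Units.inv_mul, Matrix.vecMul_one] at l₁ l₂
    exact funext fun i => D.hom_ext (congrFun l₁ i) (congrFun l₂ i)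
  have hsurj : Function.Surjective F := by
    rintro ⟨x, y⟩
    have hxy : D.g₁ ∘ Matrix.vecMul ![D.π₁ (y 0), x.1.1] P₁.1 =
        D.g₂ ∘ Matrix.vecMul ![D.π₂ (y 0), x.1.2] P₂.1 := by
      rw [← AlgHom.vecMul_mapMatrix, ← AlgHom.vecMul_mapMatrix, h, ← Matrix.vecMul_vecMul, hdiag,
        AlgHom.comp_vecCons, AlgHom.comp_vecCons, ← D.comm, ← D.M_mem u x]
      rfl
    obtain ⟨m, hm₁, hm₂⟩ := D.exists_vec_lift _ _ hxy
    have k₁ : Matrix.vecMul (D.π₁ ∘ m) P₁⁻¹.1 = ![D.π₁ (y 0), x.1.1] := by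
      rw [hm₁, Matrix.vecMul_vecMul, P₁.mul_inv, Matrix.vecMul_one]
    have k₂ : Matrix.vecMul (D.π₂ ∘ m) P₂⁻¹.1 = ![D.π₂ (y 0), x.1.2] := by
      rw [hm₂, Matrix.vecMul_vecMul, P₂.mul_inv, Matrix.vecMul_one]
    refine ⟨m, Prod.ext (Subtype.ext ?_) (funext fun i => ?_)⟩
    · rw [hF₁, k₁, k₂]; rfl
    · rw [Subsingleton.elim i 0]
      exact D.hom_ext (by rw [hF₂, k₁]; rfl) (by rw [hF₃, k₂]; rfl)
  exact ⟨1, ⟨(LinearEquiv.ofBijective F ⟨hinj, hsurj⟩).symm.trans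
    (Fin.consLinearEquiv Λ (fun _ : Fin 2 => Λ)).symm⟩⟩

/-- `M(u)` is free if `u ∈ W`. -/
theorem nonempty_linearEquiv_of_mem_W {u : Λbarˣ} (hu : u ∈ D.W) : Nonempty (D.M u ≃ₗ[Λ] Λ) := by
  obtain ⟨a, b, rfl⟩ := hu
  have key : ∀ (x₁ : Λ₁) (x₂ : Λ₂),
      D.g₁ x₁ * ((Units.map (D.g₁ : Λ₁ →* Λbar) a * Units.map (D.g₂ : Λ₂ →* Λbar) b : Λbarˣ) : Λbar)
        = D.g₂ x₂ ↔ D.g₁ (x₁ * a) = D.g₂ (x₂ * ((b⁻¹ : Λ₂ˣ) : Λ₂)) := by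
    intro x₁ x₂
    have h1 : D.g₂ ((b⁻¹ : Λ₂ˣ) : Λ₂) =
      (((Units.map (D.g₂ : Λ₂ →* Λbar) b)⁻¹ : Λbarˣ) : Λbar) := by rw [← map_inv]; rfl
    rw [map_mul, map_mul, h1, Units.eq_mul_inv_iff_mul_eq, Units.val_mul, ← mul_assoc]
    rfl
  -- For u = g₁(a)g₂(b) the element (a⁻¹, b) is a free generator of M(u).
  have hmem : ((((a⁻¹ : Λ₁ˣ) : Λ₁), (b : Λ₂)) : Λ₁ × Λ₂) ∈ D.submoduleM
      (Units.map (D.g₁ : Λ₁ →* Λbar) a * Units.map (D.g₂ : Λ₂ →* Λbar) b) := by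
    refine (key _ _).2 ?_
    simp
  refine ⟨(LinearEquiv.ofBijective (LinearMap.toSpanSingleton Λ (D.M _) ⟨_, hmem⟩)
    ⟨fun x y hxy => ?_, fun x => ?_⟩).symm⟩
  · have hxy' := congrArg Subtype.val hxy
    have h1 : D.π₁ x * ((a⁻¹ : Λ₁ˣ) : Λ₁) = D.π₁ y * ((a⁻¹ : Λ₁ˣ) : Λ₁) := congrArg Prod.fst hxy'
    have h2 : D.π₂ x * b = D.π₂ y * b := congrArg Prod.snd hxy'
    exact D.hom_ext ((Units.mul_left_inj _).1 h1) ((Units.mul_left_inj _).1 h2)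
  · refine ⟨D.lift _ _ ((key _ _).1 (D.M_mem _ x)), Subtype.ext (Prod.ext ?_ ?_)⟩
    · change D.π₁ (D.lift _ _ ((key _ _).1 (D.M_mem _ x))) * _ = _
      rw [π₁_lift, Units.mul_inv_cancel_right]
    · change D.π₂ (D.lift _ _ ((key _ _).1 (D.M_mem _ x))) * _ = _
      rw [π₂_lift, Units.inv_mul_cancel_right]

/-- If `M(u)` is free, then `u ∈ W`. -/
theorem mem_W_of_linearEquiv [IsNoetherianRing Λ₁] [IsNoetherianRing Λ₂]
    (hg : Function.Surjective D.g₂) {u : Λbarˣ} (e : Λ ≃ₗ[Λ] D.M u) : u ∈ D.W := by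
  have hgen : ∀ (x₁ : Λ₁) (x₂ : Λ₂), D.g₁ x₁ * u = D.g₂ x₂ →
      ∃ a, D.π₁ a * (e 1).1.1 = x₁ ∧ D.π₂ a * (e 1).1.2 = x₂ := by
    intro x₁ x₂ hx
    obtain ⟨a, ha⟩ := e.surjective (⟨(x₁, x₂), hx⟩ : D.M u)
    rw [← mul_one a, ← smul_eq_mul, map_smul] at ha
    have ha' := congrArg Subtype.val ha
    exact ⟨a, congrArg Prod.fst ha', congrArg Prod.snd ha'⟩
  -- Since (1, v) and (0, 1 - wv) lie in M(u), both components of the generator `e 1` have left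
  -- inverses. By noetherianity they are units, and their defining relation puts `u` in W.
  obtain ⟨v, hv⟩ := hg u
  obtain ⟨w, hw⟩ := hg ((u⁻¹ : Λbarˣ) : Λbar)
  obtain ⟨a, ha₁, ha₂⟩ := hgen 1 v (by rw [map_one, one_mul, hv])
  obtain ⟨b, -, hb⟩ := hgen 0 (1 - w * v) (by
    rw [map_zero, zero_mul, map_sub, map_mul, hv, hw, map_one, Units.inv_mul, sub_self])
  have hb' : (w * D.π₂ a + D.π₂ b) * (e 1).1.2 = 1 := by
    rw [add_mul, mul_assoc, ha₂, hb, add_sub_cancel]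
  let x₁ : Λ₁ˣ := ⟨(e 1).1.1, D.π₁ a, mul_eq_one_symm ha₁, ha₁⟩
  let x₂ : Λ₂ˣ := ⟨(e 1).1.2, w * D.π₂ a + D.π₂ b, mul_eq_one_symm hb', hb'⟩
  refine ⟨x₁⁻¹, x₂, ?_⟩
  rw [map_inv, eq_inv_mul_iff_mul_eq]
  exact Units.ext (D.M_mem u (e 1))

/-- A column and its row over Λ₁ extend to Λ: their images in Λbar lift to Λ₂, still with product 1,
because an elementary matrix brings the column to (1, 0) and the row to the form (1, ∗). -/
theorem transitive_fst (hB : ∀ a b c d : Λbar, c * a + d * b = 1 → ∃ t, IsUnit (a + t * b))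
    (hg : Function.Surjective D.g₂) (h : TransitiveOnUnimodularPairs Λ) :
    TransitiveOnUnimodularPairs Λ₁ := by
  intro v₁ w₁ hwv
  have hwv' : (D.g₁ ∘ w₁) ⬝ᵥ (D.g₁ ∘ v₁) = 1 := by rw [AlgHom.comp_dotProduct, hwv, map_one]
  obtain ⟨E, hE⟩ := exists_mapMatrix_mulVec_eq hB D.g₂ hg _ _ hwv'
  have hEi : D.g₂.mapMatrix E⁻¹.1 * D.g₂.mapMatrix E.1 = 1 := by
    rw [← map_mul, E.inv_mul, map_one]
  have he : D.g₂ ∘ ![1, 0] = ![1, 0] := by rw [AlgHom.comp_vecCons, map_one, map_zero]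
  have hv : D.g₁ ∘ v₁ = D.g₂ ∘ E⁻¹.1.mulVec ![1, 0] := by
    rw [← AlgHom.mapMatrix_mulVec, he, ← hE, Matrix.mulVec_mulVec, hEi, Matrix.one_mulVec]
  let z := Matrix.vecMul (D.g₁ ∘ w₁) (D.g₂.mapMatrix E⁻¹.1)
  have hz0 : z 0 = 1 := by
    have : z ⬝ᵥ ![1, 0] = 1 := by
      rw [← Matrix.dotProduct_mulVec, ← he, AlgHom.mapMatrix_mulVec, ← hv, hwv']
    simpa [dotProduct] using this
  obtain ⟨y, hy⟩ := hg (z 1)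
  have hyz : D.g₂ ∘ ![1, y] = z := by
    rw [AlgHom.comp_vecCons, map_one, hy, ← hz0]
    ext i; fin_cases i <;> rfl
  have hw : D.g₁ ∘ w₁ = D.g₂ ∘ Matrix.vecMul ![1, y] E.1 := by
    rw [← AlgHom.vecMul_mapMatrix, hyz, Matrix.vecMul_vecMul, hEi, Matrix.vecMul_one]
  obtain ⟨v, hv₁, hv₂⟩ := D.exists_vec_lift _ _ hv
  obtain ⟨w, hw₁, hw₂⟩ := D.exists_vec_lift _ _ hw
  obtain ⟨P, hP⟩ := h v w (D.hom_ext
    (by rw [← AlgHom.comp_dotProduct, hv₁, hw₁, hwv, map_one])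
    (by
      rw [← AlgHom.comp_dotProduct, hv₂, hw₂, ← Matrix.dotProduct_mulVec, Matrix.mulVec_mulVec,
        E.mul_inv, Matrix.one_mulVec, map_one]
      simp [dotProduct]))
  refine ⟨D.π₁.mapMatrixUnits P, ?_⟩
  change (D.π₁.mapMatrix P.1).mulVec v₁ = _
  rw [← hv₁, AlgHom.mapMatrix_mulVec, hP, AlgHom.comp_vecCons, map_one, map_zero]

/-- As `g₁` need not be surjective, a column over Λ₂ is first moved by an elementary matrix so that
its image in Λbar is (1, 0), which comes from Λ₁. -/
theorem transitive_snd (hB : ∀ a b c d : Λbar, c * a + d * b = 1 → ∃ t, IsUnit (a + t * b))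
    (hg : Function.Surjective D.g₂) (h : TransitiveOnUnimodularPairs Λ) :
    TransitiveOnUnimodularPairs Λ₂ := by
  intro v' w' hwv'
  obtain ⟨E, hE⟩ := exists_mapMatrix_mulVec_eq hB D.g₂ hg (D.g₂ ∘ v') (D.g₂ ∘ w')
    (by rw [AlgHom.comp_dotProduct, hwv', map_one])
  rw [AlgHom.mapMatrix_mulVec] at hE
  have hwv : Matrix.vecMul w' E⁻¹.1 ⬝ᵥ E.1.mulVec v' = 1 := by
    rw [← Matrix.dotProduct_mulVec, Matrix.mulVec_mulVec, E.inv_mul, Matrix.one_mulVec, hwv']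
  generalize Matrix.vecMul w' E⁻¹.1 = w at hwv
  obtain ⟨v₂, hv₂⟩ : ∃ v₂, E.1.mulVec v' = v₂ := ⟨_, rfl⟩
  rw [hv₂] at hE hwv
  have ha : D.g₂ (v₂ 0) = 1 := congrFun hE 0
  have hb : D.g₂ (v₂ 1) = 0 := congrFun hE 1
  have hcd : w 0 * v₂ 0 + w 1 * v₂ 1 = 1 := by simpa [dotProduct] using hwv
  have hc : D.g₂ (w 0) = 1 := by
    have := congrArg D.g₂ hcd
    simpa [ha, hb] using this
  obtain ⟨v, hv1, hv2⟩ := D.exists_vec_lift ![1, 0] v₂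
    (by rw [hE, AlgHom.comp_vecCons, map_one, map_zero])
  -- The image of `w 1` may not come from Λ₁. Substituting the relation w₀a + w₁b = 1 into its own
  -- second term, as w₀a + w₁b(w₀a + w₁b) = 1, gives a row whose image is (1, 0), because `b` maps
  -- to 0.
  obtain ⟨x, hx1, hx2⟩ := D.exists_vec_lift ![1, 0]
    ![w 0 + w 1 * v₂ 1 * w 0, w 1 * v₂ 1 * w 1]
    (by rw [AlgHom.comp_vecCons, AlgHom.comp_vecCons]; simp [hb, hc])
  obtain ⟨P, hP⟩ := h v x (D.hom_ext
    (by rw [← AlgHom.comp_dotProduct, hv1, hx1, map_one]; simp [dotProduct])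
    (by
      rw [← AlgHom.comp_dotProduct, hv2, hx2, map_one]
      simp only [dotProduct, Fin.sum_univ_two, Matrix.cons_val_zero, Matrix.cons_val_one]
      calc (w 0 + w 1 * v₂ 1 * w 0) * v₂ 0 + w 1 * v₂ 1 * w 1 * v₂ 1
          = w 0 * v₂ 0 + w 1 * v₂ 1 * (w 0 * v₂ 0 + w 1 * v₂ 1) := by noncomm_ring
        _ = 1 := by rw [hcd, mul_one, hcd]))
  refine ⟨D.π₂.mapMatrixUnits P * E, ?_⟩
  change (D.π₂.mapMatrix P.1 * E.1).mulVec v' = _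
  rw [← Matrix.mulVec_mulVec, hv₂, ← hv2, AlgHom.mapMatrix_mulVec, hP, AlgHom.comp_vecCons,
    map_one, map_zero]

/-- Unimodular pairs over the fibre product can be completed if this holds over both factors and
the stably free modules `M(u)` come from `u ∈ W`. -/
theorem transitive_of_factors (hg : Function.Surjective D.g₂)
    (h₁ : TransitiveOnUnimodularPairs Λ₁) (h₂ : TransitiveOnUnimodularPairs Λ₂)
    (hW : ∀ u, StablyIsomorphic Λ (D.M u) Λ → u ∈ D.W) : TransitiveOnUnimodularPairs Λ := by
  intro v w hwv
  obtain ⟨P₁, hP₁⟩ := h₁ (D.π₁ ∘ v) (D.π₁ ∘ w) (by rw [AlgHom.comp_dotProduct, hwv, map_one])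
  obtain ⟨P₂, hP₂⟩ := h₂ (D.π₂ ∘ v) (D.π₂ ∘ w) (by rw [AlgHom.comp_dotProduct, hwv, map_one])
  let Q₁ := D.g₁.mapMatrixUnits P₁
  let Q₂ := D.g₂.mapMatrixUnits P₂
  have hQ₁ : Q₁.1.mulVec (D.g₁ ∘ D.π₁ ∘ v) = ![1, 0] := by
    change (D.g₁.mapMatrix P₁.1).mulVec _ = _
    rw [AlgHom.mapMatrix_mulVec, hP₁, AlgHom.comp_vecCons, map_one, map_zero]
  have hQ₂ : Q₂.1.mulVec (D.g₁ ∘ D.π₁ ∘ v) = ![1, 0] := by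
    change (D.g₂.mapMatrix P₂.1).mulVec _ = _
    rw [comm_comp, AlgHom.mapMatrix_mulVec, hP₂, AlgHom.comp_vecCons, map_one, map_zero]
  have hfix : ∀ S T : (Matrix (Fin 2) (Fin 2) Λbar)ˣ, S.1.mulVec (D.g₁ ∘ D.π₁ ∘ v) = ![1, 0] →
      T.1.mulVec (D.g₁ ∘ D.π₁ ∘ v) = ![1, 0] →
      (S * T⁻¹).1 0 0 = 1 ∧ (S * T⁻¹).1 1 0 = 0 := by
    intro S T hS hT
    have : (S * T⁻¹).1.mulVec ![1, 0] = ![1, 0] := by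
      rw [← hT, Matrix.mulVec_mulVec, ← Units.val_mul, inv_mul_cancel_right, hS, hT]
    exact ⟨by simpa [Matrix.mulVec, dotProduct] using congrFun this 0,
      by simpa [Matrix.mulVec, dotProduct] using congrFun this 1⟩
  obtain ⟨hG0, hG1⟩ := hfix Q₁ Q₂ hQ₁ hQ₂
  obtain ⟨hG0', hG1'⟩ := hfix Q₂ Q₁ hQ₂ hQ₁
  have hGG : (Q₁ * Q₂⁻¹).1 * (Q₂ * Q₁⁻¹).1 = 1 := by rw [← Units.val_mul]; simp
  have hGG' : (Q₂ * Q₁⁻¹).1 * (Q₁ * Q₂⁻¹).1 = 1 := by rw [← Units.val_mul]; simp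
  -- Both Q₁Q₂⁻¹ and its inverse have first column (1, 0), so their lower right entries are mutually
  -- inverse.
  let u : Λbarˣ := ⟨(Q₁ * Q₂⁻¹).1 1 1, (Q₂ * Q₁⁻¹).1 1 1,
    by
      have := congrFun (congrFun hGG 1) 1
      rwa [Matrix.mul_apply, Fin.sum_univ_two, hG1, zero_mul, zero_add, Matrix.one_apply_eq] at this,
    by
      have := congrFun (congrFun hGG' 1) 1
      rwa [Matrix.mul_apply, Fin.sum_univ_two, hG1', zero_mul, zero_add,
        Matrix.one_apply_eq] at this⟩
  -- The upper right entry lifts to Λ₂ and is absorbed into `P₂`, leaving diag(1, u).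
  obtain ⟨t, ht⟩ := hg ((Q₁ * Q₂⁻¹).1 0 1)
  have hU : D.g₂.mapMatrix (upperElementary t).1 = !![1, (Q₁ * Q₂⁻¹).1 0 1; 0, 1] := by
    ext i j; fin_cases i <;> fin_cases j <;> simp [upperElementary, ht]
  have hG : (Q₁ * Q₂⁻¹).1 = (oneDiag u).1 * D.g₂.mapMatrix (upperElementary t).1 := by
    rw [hU]
    ext i j
    fin_cases i <;> fin_cases j <;> simp only [oneDiag, Matrix.mul_apply, Fin.sum_univ_two]
    · simpa using hG0
    · simp
    · simpa using hG1
    · simp [u]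
  have hfac : D.g₁.mapMatrix P₁.1 =
      (oneDiag u).1 * D.g₂.mapMatrix (upperElementary t * P₂).1 := by
    rw [Units.val_mul, map_mul, ← mul_assoc, ← hG]
    change Q₁.1 = (Q₁ * Q₂⁻¹).1 * Q₂.1
    rw [← Units.val_mul, inv_mul_cancel_right]
  obtain ⟨a, b, hab⟩ := hW u (D.stablyIsomorphic_M _ _ hfac)
  -- With u = g₁(a)g₂(b), the factors diag(1, a⁻¹) and diag(1, b) make the two matrices agree over
  -- Λbar. They fix (1, 0), so the glued matrix still completes `v`.
  have hlift : D.matrix.g₁ (oneDiag a⁻¹ * P₁).1 =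
      D.matrix.g₂ (oneDiag b * (upperElementary t * P₂)).1 := by
    change D.g₁.mapMatrix _ = D.g₂.mapMatrix _
    rw [Units.val_mul, Units.val_mul (oneDiag b), map_mul, map_mul, hfac, ← mul_assoc]
    congr 1
    have hab' : D.g₁ ((a⁻¹ : Λ₁ˣ) : Λ₁) * u = D.g₂ b := by
      rw [hab, Units.val_mul, ← mul_assoc]
      change D.g₁ ((a⁻¹ : Λ₁ˣ) : Λ₁) * D.g₁ a * D.g₂ b = D.g₂ b
      rw [← map_mul, Units.inv_mul, map_one, one_mul]
    ext i j
    fin_cases i <;> fin_cases j <;> simp [oneDiag, Matrix.mul_apply, hab']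
  obtain ⟨P, hPa, hPb⟩ := D.matrix.exists_units_lift _ _ hlift
  refine ⟨P, funext fun i => D.hom_ext ?_ ?_⟩
  · have e : D.π₁ ∘ P.1.mulVec v = ![1, 0] := by
      rw [← AlgHom.mapMatrix_mulVec]
      change (D.matrix.π₁ P.1).mulVec _ = _
      rw [hPa, Units.val_mul, ← Matrix.mulVec_mulVec, hP₁]
      ext i; fin_cases i <;> simp [oneDiag, Matrix.mulVec, dotProduct]
    refine (congrFun e i).trans ?_
    fin_cases i <;> simp
  · have e : D.π₂ ∘ P.1.mulVec v = ![1, 0] := by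
      rw [← AlgHom.mapMatrix_mulVec]
      change (D.matrix.π₂ P.1).mulVec _ = _
      rw [hPb, Units.val_mul, Units.val_mul, ← Matrix.mulVec_mulVec, ← Matrix.mulVec_mulVec, hP₂]
      ext i; fin_cases i <;> simp [oneDiag, upperElementary, Matrix.mulVec, dotProduct]
    refine (congrFun e i).trans ?_
    fin_cases i <;> simp

end FibreProduct

/-! ### The criterion for orders and the main theorem -/

instance ROrder.instIsNoetherianRing {R K A : Type*} [CommRing R] [IsNoetherianRing R] [Field K]
    [Ring A] [Algebra R K] [Algebra K A] [Algebra R A] (Λ : ROrder R K A) : IsNoetherianRing Λ :=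
  isNoetherian_of_tower R inferInstance

/-- An order over a Dedekind domain has stably free cancellation if and only if unimodular columns
of length two can be completed. -/
theorem ROrder.hasSFC_iff {R K A : Type*} [CommRing R] [IsDedekindDomain R] [Field K] [Algebra R K]
    [IsFractionRing R K] [Ring A] [Algebra K A] [Algebra R A] [IsScalarTower R K A]
    [FiniteDimensional K A] [IsSemisimpleRing A] (Λ : ROrder R K A) :
    HasSFC Λ ↔ TransitiveOnUnimodularPairs Λ :=
  ⟨HasSFC.transitiveOnUnimodularPairs, fun h => h.hasSFC fun _ _ _ _ _ h => Λ.exists_shorten h⟩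

namespace FibreProduct

section Kernel

variable {R : Type v} [CommRing R] {Λ Λ₁ Λ₂ : Type u} {Λbar : Type*} [Ring Λ]
    [Ring Λ₁] [Ring Λ₂] [Ring Λbar] [Algebra R Λ] [Algebra R Λ₁] [Algebra R Λ₂] [Algebra R Λbar]
    (D : FibreProduct R Λ Λ₁ Λ₂ Λbar)

/-- Equality of classes in Cl(Λ) is stable isomorphism, and the identity is the class of Λ. -/
theorem mem_kerBoundary_iff [IsNoetherianRing R] [Module.Finite R Λ] [Module.Finite R Λ₁]
    [Module.Finite R Λ₂] [Module.IsTorsionFree R Λ] [Module.IsTorsionFree R Λ₁]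
    [Module.IsTorsionFree R Λ₂] (hg : Function.Surjective D.g₁ ∨ Function.Surjective D.g₂)
    (u : Λbarˣ) : u ∈ D.kerBoundary hg ↔ StablyIsomorphic Λ (D.M u) Λ :=
  Quotient.eq (r := PrincipalGenus.setoid R Λ)

theorem stablyIsomorphic_of_mem_W {u : Λbarˣ} (hu : u ∈ D.W) : StablyIsomorphic Λ (D.M u) Λ := by
  obtain ⟨e⟩ := D.nonempty_linearEquiv_of_mem_W hu
  exact ⟨0, ⟨e.prodCongr (LinearEquiv.refl Λ _)⟩⟩

/-- Stably free cancellation turns a stable isomorphism `M(u) ~ Λ` into an isomorphism. -/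
theorem nonempty_linearEquiv_of_hasSFC [IsNoetherianRing R] [Module.Finite R Λ₁]
    [Module.Finite R Λ₂] (h : HasSFC Λ) {u : Λbarˣ} (hu : StablyIsomorphic Λ (D.M u) Λ) :
    Nonempty (Λ ≃ₗ[Λ] D.M u) := by
  obtain ⟨m, ⟨e⟩⟩ := hu
  have : Module.Finite Λ (D.M u) := Module.Finite.of_restrictScalars_finite R Λ _
  obtain ⟨ψ⟩ := h (D.M u) m 1 ⟨e.trans (Fin.consLinearEquiv Λ (fun _ : Fin (m + 1) => Λ))⟩
  exact ⟨(ψ.trans (LinearEquiv.funUnique (Fin 1) Λ Λ)).symm⟩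

end Kernel

variable {R K : Type*} {A A₁ A₂ : Type u} {Λbar : Type*}
    [CommRing R] [IsDedekindDomain R] [Field K] [Algebra R K] [IsFractionRing R K]
    [Ring A] [Algebra K A] [Algebra R A] [IsScalarTower R K A]
    [FiniteDimensional K A] [IsSemisimpleRing A]
    [Ring A₁] [Algebra K A₁] [Algebra R A₁] [IsScalarTower R K A₁]
    [FiniteDimensional K A₁] [IsSemisimpleRing A₁]
    [Ring A₂] [Algebra K A₂] [Algebra R A₂] [IsScalarTower R K A₂]
    [FiniteDimensional K A₂] [IsSemisimpleRing A₂]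
    [Ring Λbar] [Algebra R Λbar] {Λ : ROrder R K A} {Λ₁ : ROrder R K A₁} {Λ₂ : ROrder R K A₂}

/-- Surjectivity of `g₂` makes the torsion algebra Λbar finite over R, hence artinian, so unimodular
pairs over it shorten to units. -/
theorem hasSFC_iff_of_surjective_snd (hΛbar : Module.IsTorsion R Λbar)
    (D : FibreProduct R Λ Λ₁ Λ₂ Λbar) (hg : Function.Surjective D.g₂) :
    HasSFC Λ ↔ (HasSFC Λ₁ ∧ HasSFC Λ₂) ∧ ∀ u, StablyIsomorphic Λ (D.M u) Λ → u ∈ D.W := by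
  have : Module.Finite R Λbar := Module.Finite.of_surjective D.g₂.toLinearMap hg
  have : IsArtinianRing Λbar := isArtinianRing_of_isTorsion hΛbar
  have hB : ∀ a b c d : Λbar, c * a + d * b = 1 → ∃ t, IsUnit (a + t * b) :=
    fun _ _ _ _ h => exists_isUnit_add_mul_of_isArtinianRing R h
  constructor
  · intro h
    refine ⟨⟨?_, ?_⟩, fun u hu => ?_⟩
    · exact Λ₁.hasSFC_iff.2 (D.transitive_fst hB hg (Λ.hasSFC_iff.1 h))
    · exact Λ₂.hasSFC_iff.2 (D.transitive_snd hB hg (Λ.hasSFC_iff.1 h))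
    · obtain ⟨e⟩ := D.nonempty_linearEquiv_of_hasSFC h hu
      exact D.mem_W_of_linearEquiv hg e
  · rintro ⟨⟨h₁, h₂⟩, hW⟩
    exact Λ.hasSFC_iff.2
      (D.transitive_of_factors hg (Λ₁.hasSFC_iff.1 h₁) (Λ₂.hasSFC_iff.1 h₂) hW)

theorem hasSFC_iff_of_surjective (hΛbar : Module.IsTorsion R Λbar)
    (D : FibreProduct R Λ Λ₁ Λ₂ Λbar)
    (hg : Function.Surjective D.g₁ ∨ Function.Surjective D.g₂) :
    HasSFC Λ ↔ (HasSFC Λ₁ ∧ HasSFC Λ₂) ∧ ∀ u, StablyIsomorphic Λ (D.M u) Λ → u ∈ D.W := by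
  rcases hg with hg | hg
  -- Interchanging the factors replaces `u` by its inverse, both in M(u) and in W.
  · rw [hasSFC_iff_of_surjective_snd hΛbar D.swap hg, and_comm (a := HasSFC Λ₂)]
    refine and_congr_right fun _ => ⟨fun h u hu => ?_, fun h u hu => ?_⟩
    · obtain ⟨m, ⟨e⟩⟩ := hu
      have := D.swap.inv_mem_W_swap (h u⁻¹
        ⟨m, ⟨((D.swapEquiv u).symm.prodCongr (LinearEquiv.refl Λ _)).trans e⟩⟩)
      rwa [inv_inv] at this
    · obtain ⟨m, ⟨e⟩⟩ := hu
      have := D.inv_mem_W_swap (h u⁻¹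
        ⟨m, ⟨((D.swap.swapEquiv u).symm.prodCongr (LinearEquiv.refl Λ _)).trans e⟩⟩)
      rwa [inv_inv] at this
  · exact hasSFC_iff_of_surjective_snd hΛbar D hg

end FibreProduct

theorem mainTheorem8
    {R K : Type*} {A A₁ A₂ : Type u} {Λbar : Type*}
    [CommRing R] [IsDedekindDomain R] [Field K] [NumberField K] [Algebra R K] [IsFractionRing R K]
    [Ring A] [Algebra K A] [Algebra R A] [IsScalarTower R K A]
    [FiniteDimensional K A] [IsSemisimpleRing A]
    [Ring A₁] [Algebra K A₁] [Algebra R A₁] [IsScalarTower R K A₁]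
    [FiniteDimensional K A₁] [IsSemisimpleRing A₁]
    [Ring A₂] [Algebra K A₂] [Algebra R A₂] [IsScalarTower R K A₂]
    [FiniteDimensional K A₂] [IsSemisimpleRing A₂]
    [Ring Λbar] [Algebra R Λbar] (hΛbar : Module.IsTorsion R Λbar)
    (Λ : ROrder R K A) (Λ₁ : ROrder R K A₁) (Λ₂ : ROrder R K A₂)
    (D : FibreProduct R Λ Λ₁ Λ₂ Λbar)
    (hg : Function.Surjective D.g₁ ∨ Function.Surjective D.g₂) :
    HasSFC Λ ↔ (HasSFC Λ₁ ∧ HasSFC Λ₂) ∧ D.W = D.kerBoundary hg := by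
  rw [FibreProduct.hasSFC_iff_of_surjective hΛbar D hg]
  refine and_congr_right fun _ => ⟨fun h => Set.ext fun u => ?_, fun h u hu => ?_⟩
  · rw [D.mem_kerBoundary_iff hg]
    exact ⟨D.stablyIsomorphic_of_mem_W, h u⟩
  · rw [h, D.mem_kerBoundary_iff hg]
    exact hu
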